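/- Conventions. Let $G$ be a countable group. A (left) Følner sequence is a sequence $(F_n)$ of non-empty finite subsets of $G$ with $|gF_n\triangle F_n|/|F_n|\to 0$ for every $g\in G$; $G$ is amenable if it has one. A measure-preserving system $(Y,\nu,G)$ is a measure-preserving action of $G$ on a standard probability space without atoms; $\cong$ denotes measure-theoretic isomorphism (mod $0$) of actions. Fix a Følner sequence $(F_n)$. The entropy of $(Y,\nu,G)$ is $$h(Y,\nu,G)=\sup_{\xi}\ \lim_{n\to\infty}\frac1{|F_n|}H\Big(\bigvee_{g\in F_n}g^{-1}\xi\Big),$$ the supremum being over countable measurable partitions $\xi$ of finite Shannon entropy $H(\xi)$. For a continuous action of $G$ on a compact metric space $(X,d)$, the topological entropy is $$h_{top}(X,G)=\sup_{\varepsilon>0}\limsup_{n\to\infty}\frac1{|F_n|}\log \mathrm{spn}(d,F_n,\varepsilon),$$ where $\mathrm{spn}(d,S,\varepsilon)$ is the minimal cardinality of an $\varepsilon$-net of $X$ for the semimetric $\max_{g\in S}d(gx,gy)$. (Both values are independent of the choice of $(F_n)$.) Scaling entropy. For a measurable semimetric $\rho$ on $(Y,\nu)$ and $\varepsilon>0$,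 let $\mathbb H_\varepsilon(Y,\nu,\rho)=\log_2 k$, where $k\ge 1$ is the least integer such that $Y=X_0\cup X_1\cup\dots\cup X_k$ with $X_i$ measurable, $\nu(X_0)<\varepsilon$ and $\mathrm{diam}_\rho(X_i)<\varepsilon$ for $i\ge1$ (and $+\infty$ if there is no such $k$). The semimetric $\rho$ is admissible if it is separable on a subset of full measure, and summable if $\rho\in L^1(\nu\times\nu)$. Let $\theta=\{W_n\}$ be a Følner sequence (an equipment of $G$). The semimetric $\rho$ is generating if there is a set $Y_0$ of full measure such that for all distinct $x,y\in Y_0$ there is $g\in\bigcup_n W_n$ with $\rho(gx,gy)>0$. Put $G_{av}^n\rho(x,y)=\frac1{|W_n|}\sum_{g\in W_n}\rho(gx,gy)$ and $\Phi_\rho(n,\varepsilon)=\mathbb H_\varepsilon(Y,\nu,G^n_{av}\rho)$. For sequences, $\phi\lesssim\psi$ means that $\phi(n)\le C\psi(n)$ for all $n$, for some constant $C>0$. For functions of $(n,\varepsilon)$, $\Psi\preceq\Phi$ means that for every $\varepsilon>0$ there is $\delta>0$ with $\Psi(\cdot,\varepsilon)\lesssim\Phi(\cdot,\delta)$; $\Psi$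 and $\Phi$ are equivalent if $\Psi\preceq\Phi\preceq\Psi$. The class $\mathcal H(Y,\nu,G,\theta)$ consists of all functions $\Phi(n,\varepsilon)\ge0$, non-increasing in $\varepsilon>0$, that are equivalent to $\Phi_\rho$ for some admissible generating summable semimetric $\rho$ (the equivalence class of $\Phi_\rho$ does not depend on $\rho$). The group $G$ equipped with $\theta=\{W_n\}$ admits actions of almost complete growth if for every non-negative function $\phi(n)=o(|W_n|)$ there is a measure-preserving system $(Y,\nu,G)$ such that for every $\Phi\in\mathcal H(Y,\nu,G,\theta)$ and every sufficiently small $\varepsilon>0$ $$\Phi(\cdot,\varepsilon)\not\lesssim\phi\qquad\text{and}\qquad \Phi(n,\varepsilon)=o(|W_n|).$$ Theorem. Let $G$ be a countable amenable group acting continuously on a compact metric space $(X,d)$. Suppose that $G$ admits actions of almost complete growth for some Følner equipment $\theta=\{W_n\}$, and that for every measure-preserving system $(Y,\nu,G)$ with $h(Y,\nu,G)=0$ there is a $G$-invariant Borel probability measure $\mu$ on $X$ with $(X,\mu,G)\cong(Y,\nu,G)$. Then $h_{top}(X,G)>0$. -/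

import Mathlib

open MeasureTheory Filter Topology
open scoped ENNReal NNReal Pointwise symmDiff

noncomputable section

namespace ScalingEntropy

/-- A (left) Følner sequence of a discrete group: non-empty finite sets `F n` with
`|g F n ∆ F n| / |F n| → 0` for every `g`. -/
structure IsLeftFolner {G : Type*} [Group G] (F : ℕ → Finset G) : Prop where
  nonempty : ∀ n, (F n).Nonempty
  tendsto : ∀ g : G, Tendsto
    (fun n => (((g • (F n : Set G)) ∆ (F n : Set G)).ncard : ℝ) / ((F n).card : ℝ)) atTop (𝓝 0)

/-- A measure-preserving system of the group `G`: a measure-preserving action of `G` on a standard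
probability space without point masses. (Every such space is isomorphic to the unit interval with
the Lebesgue measure, so nothing is lost by taking the carrier in `Type`.) -/
structure MPSystem (G : Type*) [Group G] where
  carrier : Type
  [measurableSpace : MeasurableSpace carrier]
  [standardBorel : StandardBorelSpace carrier]
  [action : MulAction G carrier]
  [measurableAction : MeasurableConstSMul G carrier]
  measure : Measure carrier
  [isProbability : IsProbabilityMeasure measure]
  [noAtoms : NullSingletonClass measure]
  [invariant : SMulInvariantMeasure G carrier measure]

attribute [instance] MPSystem.measurableSpace MPSystem.standardBorel MPSystem.action
  MPSystem.measurableAction MPSystem.isProbability MPSystem.noAtoms MPSystem.invariant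

/-- Isomorphism (mod 0) of two measure-preserving actions of the same countable group. -/
def Isomorphic (G : Type*) [Group G] {X Y : Type*} [MeasurableSpace X] [MeasurableSpace Y]
    [MulAction G X] [MulAction G Y] (μ : Measure X) (ν : Measure Y) : Prop :=
  ∃ (f : X → Y) (f' : Y → X), MeasurePreserving f μ ν ∧ MeasurePreserving f' ν μ ∧
    (∀ᵐ x ∂μ, f' (f x) = x) ∧ (∀ᵐ y ∂ν, f (f' y) = y) ∧
    ∀ g : G, ∀ᵐ x ∂μ, f (g • x) = g • f x

/-! ### Topological entropy -/

section Topological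

variable {G : Type*} [Group G] (X : Type*) [MetricSpace X] [MulAction G X]

/-- The minimal cardinality of an `ε`-net of `X` for the semimetric
`max_{g ∈ S} d (g x) (g y)`. -/
def spn (S : Finset G) (ε : ℝ) : ℕ :=
  sInf {k : ℕ | ∃ N : Finset X, N.card = k ∧
    ∀ x : X, ∃ y ∈ N, ∀ g ∈ S, dist (g • x) (g • y) < ε}

/-- The topological entropy, computed along the sequence `F`. -/
def topEntropy (F : ℕ → Finset G) : ℝ≥0∞ :=
  ⨆ (ε : ℝ) (_ : 0 < ε),
    limsup (fun n => ENNReal.ofReal (Real.log (spn X (F n) ε)) / ((F n).card : ℝ≥0∞)) atTop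

end Topological

/-! ### Amenable measure entropy -/

section Measure

variable {G : Type*} [Group G] {Y : Type*} [MeasurableSpace Y] [MulAction G Y]

/-- The Shannon entropy of the countable partition of `Y` into the level sets of `ξ`. -/
def partitionEntropy (ν : Measure Y) {α : Type*} [Countable α] (ξ : Y → α) : ℝ≥0∞ :=
  ∑' a : α, ENNReal.ofReal (Real.negMulLog (ν.real (ξ ⁻¹' {a})))

/-- The labelling of the refinement `⋁_{g ∈ S} g⁻¹ ξ`: two points are in the same cell if and only
if `g x`, `g y` are in the same cell of `ξ` for all `g ∈ S`. -/
def refine (S : Finset G) (ξ : Y → ℕ) : Y → (S → ℕ) :=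
  fun y g => ξ ((g : G) • y)

/-- The entropy `h(ξ)` of a partition with respect to the action, computed along `F`. -/
def dynamicalPartitionEntropy (ν : Measure Y) (F : ℕ → Finset G) (ξ : Y → ℕ) : ℝ≥0∞ :=
  limsup (fun n => partitionEntropy ν (refine (F n) ξ) / ((F n).card : ℝ≥0∞)) atTop

/-- The amenable measure entropy: the supremum of `h(ξ)` over all countable measurable partitions
`ξ` with finite Shannon entropy. -/
def measureEntropy (ν : Measure Y) (F : ℕ → Finset G) : ℝ≥0∞ :=
  ⨆ (ξ : Y → ℕ) (_ : Measurable ξ) (_ : partitionEntropy ν ξ < ∞),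
    dynamicalPartitionEntropy ν F ξ

end Measure

/-! ### Scaling entropy -/

section Scaling

variable {G : Type*} [Group G] {Y : Type*} [MeasurableSpace Y] [MulAction G Y]

/-- The diameter of a set with respect to `ρ`. -/
def semiDiam (ρ : Y → Y → ℝ) (A : Set Y) : ℝ≥0∞ :=
  ⨆ (x ∈ A) (y ∈ A), ENNReal.ofReal (ρ x y)

/-- `Y` is a union of measurable sets `A 0, …, A k` such that `ν (A 0) < ε` and all the other
sets have `ρ`-diameter less than `ε`. -/
def HasSmallCover (ν : Measure Y) (ρ : Y → Y → ℝ) (ε : ℝ) (k : ℕ) : Prop :=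
  ∃ A : Fin (k + 1) → Set Y, (∀ i, MeasurableSet (A i)) ∧ (⋃ i, A i) = Set.univ ∧
    ν (A 0) < ENNReal.ofReal ε ∧ ∀ i, i ≠ 0 → semiDiam ρ (A i) < ENNReal.ofReal ε

/-- The `ε`-entropy `log₂ k`, with `k` the least positive integer such that `HasSmallCover`
holds, and `∞` if there is none. -/
def epsEntropy (ν : Measure Y) (ρ : Y → Y → ℝ) (ε : ℝ) : ℝ≥0∞ :=
  ⨅ (k : ℕ) (_ : 0 < k ∧ HasSmallCover ν ρ ε k), ENNReal.ofReal (Real.logb 2 k)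

/-- The average of the shifts of `ρ` over the finite set `S`. -/
def avgSemimetric (S : Finset G) (ρ : Y → Y → ℝ) : Y → Y → ℝ :=
  fun x y => (∑ g ∈ S, ρ (g • x) (g • y)) / (S.card : ℝ)

/-- A summable measurable semimetric; measurability is with respect to the completed product
measure and is part of integrability. -/
structure IsSummableSemimetric (ν : Measure Y) (ρ : Y → Y → ℝ) : Prop where
  self : ∀ x, ρ x x = 0
  nonneg : ∀ x y, 0 ≤ ρ x y
  symm : ∀ x y, ρ x y = ρ y x
  triangle : ∀ x y z, ρ x z ≤ ρ x y + ρ y z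
  integrable : Integrable (fun p : Y × Y => ρ p.1 p.2) (ν.prod ν)

/-- A semimetric is admissible if it is separable on some subset of full measure. -/
def IsAdmissible (ν : Measure Y) (ρ : Y → Y → ℝ) : Prop :=
  ∃ Y₀ : Set Y, ν Y₀ᶜ = 0 ∧ ∃ D : Set Y, D ⊆ Y₀ ∧ D.Countable ∧
    ∀ x ∈ Y₀, ∀ ε : ℝ, 0 < ε → ∃ y ∈ D, ρ x y < ε

/-- A semimetric is generating for the equipment `W` if its shifts by the elements of `⋃ n, W n`
together separate the points of some subset of full measure. -/
def IsGenerating (ν : Measure Y) (W : ℕ → Finset G) (ρ : Y → Y → ℝ) : Prop :=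
  ∃ Y₀ : Set Y, ν Y₀ᶜ = 0 ∧ ∀ x ∈ Y₀, ∀ y ∈ Y₀, x ≠ y →
    ∃ n, ∃ g ∈ W n, 0 < ρ (g • x) (g • y)

/-- `φ ≲ ψ`: there is a constant `C > 0` such that `φ n ≤ C ψ n` for all `n`. -/
def Dominated (φ ψ : ℕ → ℝ≥0∞) : Prop :=
  ∃ C : ℝ≥0, 0 < C ∧ ∀ n, φ n ≤ C * ψ n

/-- The preorder on functions of `(n, ε)`. -/
def Preceq (Ψ Φ : ℕ → ℝ → ℝ≥0∞) : Prop :=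
  ∀ ε : ℝ, 0 < ε → ∃ δ : ℝ, 0 < δ ∧ Dominated (fun n => Ψ n ε) (fun n => Φ n δ)

/-- The scaling entropy of the system with respect to the equipment `W`: the class of the functions
`Φ(n, ε)`, non-increasing in `ε > 0`, that are equivalent to the `ε`-entropy of the averages
of an admissible generating summable semimetric. -/
def scalingEntropy (ν : Measure Y) (W : ℕ → Finset G) : Set (ℕ → ℝ → ℝ≥0∞) :=
  {Φ | (∀ n, AntitoneOn (Φ n) (Set.Ioi 0)) ∧
    ∃ ρ : Y → Y → ℝ, IsSummableSemimetric ν ρ ∧ IsAdmissible ν ρ ∧ IsGenerating ν W ρ ∧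
      Preceq Φ (fun n ε => epsEntropy ν (avgSemimetric (W n) ρ) ε) ∧
      Preceq (fun n ε => epsEntropy ν (avgSemimetric (W n) ρ) ε) Φ}

/-- The group `G` with the equipment `W` admits actions of almost complete growth. -/
def AdmitsAlmostCompleteGrowth (W : ℕ → Finset G) : Prop :=
  ∀ φ : ℕ → ℝ, (∀ n, 0 ≤ φ n) → φ =o[atTop] (fun n => ((W n).card : ℝ)) →
    ∃ S : MPSystem G, ∀ Φ ∈ scalingEntropy S.measure W, ∃ ε₀ : ℝ, 0 < ε₀ ∧
      ∀ ε : ℝ, 0 < ε → ε < ε₀ →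
        ¬ Dominated (fun n => Φ n ε) (fun n => ENNReal.ofReal (φ n)) ∧
        Tendsto (fun n => Φ n ε / ((W n).card : ℝ≥0∞)) atTop (𝓝 0)

end Scaling

end ScalingEntropy

end

/-! Suppose the topological entropy vanishes. Then for every scale `ε` the space is covered by `2 ^
o(|W n|)` open sets of small diameter for the metric averaged over `W n`. These covers do not depend
on a measure, so they bound the scaling entropy of all invariant measures on `X` at once. Taking the
scales `1 / (j + 1)`, a diagonal argument (`exists_isLittleO_dominating`) yields one sequence `φ =
o(|W n|)` dominating all these bounds.

Almost complete growth supplies a system whose scaling entropy is not dominated by `φ` at small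
scales but is still `o(|W n|)`. The latter forces zero measure entropy
(`measureEntropy_eq_zero_of_scalingEntropy`), so the system is realized on `X`. The metric of `X`
pulled back along the isomorphism is admissible, summable and generating, and its scaling entropy is
dominated by `φ`: a contradiction.

Both entropies are computed along `F` and the growth along `W`. A crude covering lemma passes
between them: finitely many translates `T * c` cover all but a `δ`-fraction of a far Følner set,
with total size at most `2 / δ` times that set. The factor `2 / δ` is harmless because only
vanishing rates are transferred, so no quasi-tiling is needed. -/

noncomputable section

namespace ScalingEntropy

/-! ### Covering Følner sets by translates of a finite set -/

section Covering

variable {G : Type*} [Group G]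

-- Double counting of the pairs `(t, u)` with `c = t⁻¹ * u` in `W`. By invariance each `t` admits at
-- least `|U| - δ / 2 * |W| > δ / 2 * |W|` of them, so some `c ∈ W` must receive its average share.
open scoped Classical in
theorem exists_translate_inter_large {W T U : Finset G} {δ : ℝ}
    (hinv : ∀ t ∈ T, ((W.filter fun w => t⁻¹ * w ∉ W).card : ℝ) ≤ δ / 2 * W.card)
    (hT : T.Nonempty) (hUW : U ⊆ W) (hU : δ * W.card < U.card) :
    ∃ c : G, δ / 2 * T.card ≤ (U.filter fun u => u * c⁻¹ ∈ T).card := by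
  by_contra! hlt
  have hinj : ∑ t ∈ T, (U.filter fun u => t⁻¹ * u ∈ W).card ≤
      ∑ c ∈ W, (U.filter fun u => u * c⁻¹ ∈ T).card := by
    rw [← Finset.card_sigma, ← Finset.card_sigma]
    refine Finset.card_le_card_of_injOn (fun p => ⟨p.1⁻¹ * p.2, p.2⟩) ?_ ?_
    · rintro ⟨t, u⟩ h
      simp only [Finset.coe_sigma, Set.mem_sigma_iff, Finset.mem_coe, Finset.mem_filter] at h ⊢
      refine ⟨h.2.2, h.2.1, ?_⟩
      simpa using h.1
    · rintro ⟨t, u⟩ - ⟨t', u'⟩ - h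
      simp only [Sigma.mk.injEq, heq_eq_eq] at h
      obtain ⟨h1, rfl⟩ := h
      simpa using h1
  have hlow : ∀ t ∈ T, (U.card : ℝ) - δ / 2 * W.card ≤
      (U.filter fun u => t⁻¹ * u ∈ W).card := by
    intro t ht
    have h1 := Finset.card_filter_add_card_filter_not (s := U) (fun u => t⁻¹ * u ∈ W)
    have h2 : (U.filter fun u => ¬ t⁻¹ * u ∈ W).card ≤ (W.filter fun w => t⁻¹ * w ∉ W).card :=
      Finset.card_le_card (Finset.filter_subset_filter _ hUW)
    have h3 := hinv t ht
    have h4 : ((U.filter fun u => t⁻¹ * u ∈ W).card : ℝ) +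
      (U.filter fun u => ¬ t⁻¹ * u ∈ W).card = U.card := by exact_mod_cast h1
    have h5 : ((U.filter fun u => ¬ t⁻¹ * u ∈ W).card : ℝ) ≤
      (W.filter fun w => t⁻¹ * w ∉ W).card := by exact_mod_cast h2
    linarith
  have hsum1 : (T.card : ℝ) * (U.card - δ / 2 * W.card) ≤
      ∑ t ∈ T, ((U.filter fun u => t⁻¹ * u ∈ W).card : ℝ) := by
    rw [← nsmul_eq_mul]
    exact Finset.card_nsmul_le_sum _ _ _ hlow
  have hsum2 : ∑ c ∈ W, ((U.filter fun u => u * c⁻¹ ∈ T).card : ℝ) ≤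
      W.card * (δ / 2 * T.card) := by
    rw [← nsmul_eq_mul]
    exact Finset.sum_le_card_nsmul _ _ _ fun c _ => (hlt c).le
  have hinj' : ∑ t ∈ T, ((U.filter fun u => t⁻¹ * u ∈ W).card : ℝ) ≤
      ∑ c ∈ W, ((U.filter fun u => u * c⁻¹ ∈ T).card : ℝ) := by exact_mod_cast hinj
  have hTpos : (0 : ℝ) < T.card := by exact_mod_cast hT.card_pos
  nlinarith

-- Greedy choice: while more than `δ * |W|` points remain, remove a translate `T * c` meeting them
-- in at least `δ / 2 * |T|` points. The removed pieces are disjoint, which bounds the number of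
-- steps; `V` is the remainder.
open scoped Classical in
theorem exists_translate_cover_of_invariant {W T : Finset G} {δ : ℝ} (hδ : 0 < δ)
    (hinv : ∀ t ∈ T, ((W.filter fun w => t⁻¹ * w ∉ W).card : ℝ) ≤ δ / 2 * W.card)
    (hT : T.Nonempty) (U : Finset G) (hUW : U ⊆ W) :
    ∃ C V : Finset G, δ / 2 * T.card * C.card ≤ U.card ∧ (V.card : ℝ) ≤ δ * W.card ∧
      ∀ u ∈ U, u ∈ V ∨ ∃ c ∈ C, ∃ t ∈ T, u = t * c := by
  induction hn : U.card using Nat.strong_induction_on generalizing U with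
  | _ n ih =>
    subst hn
    rcases le_or_gt (U.card : ℝ) (δ * W.card) with hU | hU
    · exact ⟨∅, U, by simp, hU, fun u hu => Or.inl hu⟩
    obtain ⟨c, hc⟩ := exists_translate_inter_large hinv hT hUW hU
    have hTpos : (0 : ℝ) < T.card := by exact_mod_cast hT.card_pos
    have hsplit : ((U.filter fun u => u * c⁻¹ ∈ T).card : ℝ) +
        (U.filter fun u => ¬ u * c⁻¹ ∈ T).card = U.card := by
      exact_mod_cast Finset.card_filter_add_card_filter_not (s := U) (fun u => u * c⁻¹ ∈ T)
    have hpos : (0 : ℝ) < δ / 2 * T.card := by positivity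
    obtain ⟨C, V, hC, hV, hcov⟩ := ih (U.filter fun u => ¬ u * c⁻¹ ∈ T).card
      (by rw [← Nat.cast_lt (α := ℝ)]; linarith) _ ((Finset.filter_subset _ _).trans hUW) rfl
    refine ⟨insert c C, V, ?_, hV, fun u hu => ?_⟩
    · have : ((insert c C).card : ℝ) ≤ C.card + 1 := by exact_mod_cast Finset.card_insert_le c C
      nlinarith
    · by_cases huc : u * c⁻¹ ∈ T
      · exact Or.inr ⟨c, Finset.mem_insert_self _ _, u * c⁻¹, huc, by simp⟩
      · rcases hcov u (Finset.mem_filter.2 ⟨hu, huc⟩) with h | ⟨c', hc', h⟩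
        · exact Or.inl h
        · exact Or.inr ⟨c', Finset.mem_insert_of_mem hc', h⟩

/-- Far along a Følner sequence, few translates of a given finite set cover most of the set. -/
theorem IsLeftFolner.exists_translate_cover {W : ℕ → Finset G} (hW : IsLeftFolner W) {δ : ℝ}
    (hδ : 0 < δ) {T : Finset G} (hT : T.Nonempty) :
    ∀ᶠ n in atTop, ∃ C V : Finset G, (T.card : ℝ) * C.card ≤ 2 / δ * (W n).card ∧
      (V.card : ℝ) ≤ δ * (W n).card ∧
      ∀ w ∈ W n, w ∈ V ∨ ∃ c ∈ C, ∃ t ∈ T, w = t * c := by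
  classical
  have hev : ∀ᶠ n in atTop, ∀ t ∈ T,
      (((t • (W n : Set G)) ∆ (W n : Set G)).ncard : ℝ) / ((W n).card : ℝ) < δ / 2 := by
    rw [Filter.eventually_all_finset]
    exact fun t _ => (hW.tendsto t).eventually_lt_const (by positivity)
  filter_upwards [hev] with n hn
  have hpos : (0 : ℝ) < (W n).card := by exact_mod_cast (hW.nonempty n).card_pos
  have hinv : ∀ t ∈ T, (((W n).filter fun w => t⁻¹ * w ∉ W n).card : ℝ) ≤
      δ / 2 * (W n).card := by
    intro t ht
    refine le_trans ?_ ((div_lt_iff₀ hpos).1 (hn t ht)).le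
    rw [Nat.cast_le, ← Set.ncard_coe_finset]
    refine Set.ncard_le_ncard (fun w hw => ?_) ?_
    · simp only [Finset.coe_filter, Set.mem_ofPred_eq] at hw
      refine Or.inr ⟨hw.1, fun h => hw.2 ?_⟩
      simpa [Set.mem_smul_set_iff_inv_smul_mem] using h
    · rw [Set.symmDiff_def]
      exact (((W n).finite_toSet.smul_set).sdiff).union ((W n).finite_toSet.sdiff)
  obtain ⟨C, V, hC, hV, h⟩ := exists_translate_cover_of_invariant hδ hinv hT (W n) subset_rfl
  refine ⟨C, V, ?_, hV, h⟩
  rw [div_mul_eq_mul_div, le_div_iff₀ hδ]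
  linarith

end Covering

/-! ### Shannon entropy of countable partitions -/

section Shannon

/-- The tangent at `s` lies above the concave function `-t log t`. The entropy bounds below come
from various choices of `s`. -/
theorem negMulLog_le_tangent {s t : ℝ} (hs : 0 < s) (ht : 0 ≤ t) :
    Real.negMulLog t ≤ s - t - t * Real.log s := by
  rcases ht.eq_or_lt with rfl | ht
  · simpa using hs.le
  have h := Real.log_le_sub_one_of_pos (div_pos hs ht)
  rw [Real.log_div hs.ne' ht.ne'] at h
  have h2 := mul_le_mul_of_nonneg_left h ht.le
  have h3 : t * (s / t - 1) = s - t := by field_simp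
  rw [Real.negMulLog]
  linarith

/-- A substitute for monotonicity, which `-t log t` lacks on `[0, 1]`. -/
theorem negMulLog_le_add_of_le {p q : ℝ} (hq : 0 ≤ q) (hqp : q ≤ p) (hp : p ≤ 1) :
    Real.negMulLog q ≤ p + Real.negMulLog p := by
  rcases (hq.trans hqp).eq_or_lt with rfl | hp0
  · simp [le_antisymm hqp hq]
  have h1 := negMulLog_le_tangent hp0 hq
  have h2 := Real.log_nonpos hp0.le hp
  rw [Real.negMulLog]
  rw [Real.negMulLog] at h1 ⊢
  nlinarith

variable {Y : Type*} [MeasurableSpace Y] {ν : Measure Y}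
variable {α β : Type*} [Countable α] [MeasurableSpace α] [MeasurableSingletonClass α]
  [Countable β] [MeasurableSpace β] [MeasurableSingletonClass β]

theorem tsum_measure_inter_preimage (ν : Measure Y) {g : Y → β} (hg : Measurable g) {A : Set Y}
    (hA : MeasurableSet A) : ∑' b, ν (A ∩ g ⁻¹' {b}) = ν A := by
  rw [← measure_iUnion]
  · congr 1
    ext y
    simp
  · intro b b' hb
    refine Set.disjoint_left.2 fun y hy hy' => hb ?_
    simpa using hy.2.symm.trans hy'.2
  · exact fun b => hA.inter (hg (measurableSet_singleton b))

theorem tsum_measure_preimage (ν : Measure Y) [IsProbabilityMeasure ν] {g : Y → β}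
    (hg : Measurable g) : ∑' b, ν (g ⁻¹' {b}) = 1 := by
  simpa using tsum_measure_inter_preimage ν hg MeasurableSet.univ

variable [IsProbabilityMeasure ν]

theorem ofReal_negMulLog_measureReal (s : Set Y) :
    ENNReal.ofReal (Real.negMulLog (ν.real s)) =
      ν s * ENNReal.ofReal (-Real.log (ν.real s)) := by
  rw [Real.negMulLog, neg_mul, ← mul_neg, ENNReal.ofReal_mul measureReal_nonneg, ofReal_measureReal]

theorem partitionEntropy_mono {f : Y → α} {g : Y → β} (hf : Measurable f) (hg : Measurable g)
    (h : ∀ x y, g x = g y → f x = f y) : partitionEntropy ν f ≤ partitionEntropy ν g := by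
  simp only [partitionEntropy, ofReal_negMulLog_measureReal]
  calc ∑' a, ν (f ⁻¹' {a}) * ENNReal.ofReal (-Real.log (ν.real (f ⁻¹' {a})))
      = ∑' a, ∑' b, ν (f ⁻¹' {a} ∩ g ⁻¹' {b}) *
          ENNReal.ofReal (-Real.log (ν.real (f ⁻¹' {a}))) := by
        refine tsum_congr fun a => ?_
        rw [ENNReal.tsum_mul_right,
          tsum_measure_inter_preimage ν hg (hf (measurableSet_singleton a))]
    _ = ∑' b, ∑' a, ν (f ⁻¹' {a} ∩ g ⁻¹' {b}) *
          ENNReal.ofReal (-Real.log (ν.real (f ⁻¹' {a}))) := ENNReal.tsum_comm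
    _ ≤ _ := by
        refine ENNReal.tsum_le_tsum fun b => ?_
        rcases eq_or_ne (ν (g ⁻¹' {b})) 0 with h0 | h0
        · rw [h0, zero_mul, nonpos_iff_eq_zero, ENNReal.tsum_eq_zero]
          intro a
          rw [measure_mono_null Set.inter_subset_right h0, zero_mul]
        obtain ⟨y, hy⟩ := nonempty_of_measure_ne_zero h0
        have hsub : g ⁻¹' {b} ⊆ f ⁻¹' {f y} := fun x hx => h x y (hx.trans hy.symm)
        rw [tsum_eq_single (f y)]
        · rw [Set.inter_eq_right.2 hsub]
          gcongr
          · exact ENNReal.toReal_pos h0 (measure_ne_top _ _)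
          · exact measure_ne_top _ _
        · intro a ha
          have : f ⁻¹' {a} ∩ g ⁻¹' {b} = ∅ := by
            ext x
            simp only [Set.mem_inter_iff, Set.mem_empty_iff_false, iff_false, not_and]
            exact fun hx hx' => ha (hx.symm.trans (hsub hx'))
          rw [this, measure_empty, zero_mul]

theorem partitionEntropy_prodMk_le {f : Y → α} {g : Y → β} (hf : Measurable f)
    (hg : Measurable g) :
    partitionEntropy ν (fun y => (f y, g y)) ≤ partitionEntropy ν f + partitionEntropy ν g := by
  have hfm := fun a => hf (measurableSet_singleton a)
  have hgm := fun b => hg (measurableSet_singleton b)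
  have hpre : ∀ p : α × β, (fun y => (f y, g y)) ⁻¹' {p} = f ⁻¹' {p.1} ∩ g ⁻¹' {p.2} := by
    rintro ⟨a, b⟩
    ext y
    simp
  -- Gibbs' inequality: the tangent at the product weight `u * v`, applied cell by cell. Adding the
  -- total mass 1 to both sides avoids subtraction, so infinite entropies need no separate case.
  have key : partitionEntropy ν (fun y => (f y, g y)) +
      ∑' p : α × β, ν (f ⁻¹' {p.1} ∩ g ⁻¹' {p.2}) ≤
      partitionEntropy ν f + partitionEntropy ν g +
        ∑' p : α × β, ν (f ⁻¹' {p.1}) * ν (g ⁻¹' {p.2}) := by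
    have e1 : partitionEntropy ν f = ∑' p : α × β, ν (f ⁻¹' {p.1} ∩ g ⁻¹' {p.2}) *
        ENNReal.ofReal (-Real.log (ν.real (f ⁻¹' {p.1}))) := by
      rw [ENNReal.tsum_prod']
      simp only [partitionEntropy, ofReal_negMulLog_measureReal, ENNReal.tsum_mul_right]
      exact tsum_congr fun a => by rw [tsum_measure_inter_preimage ν hg (hfm a)]
    have e2 : partitionEntropy ν g = ∑' p : α × β, ν (f ⁻¹' {p.1} ∩ g ⁻¹' {p.2}) *
        ENNReal.ofReal (-Real.log (ν.real (g ⁻¹' {p.2}))) := by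
      rw [ENNReal.tsum_prod', ENNReal.tsum_comm]
      simp only [partitionEntropy, ofReal_negMulLog_measureReal, ENNReal.tsum_mul_right]
      refine tsum_congr fun b => ?_
      simp_rw [Set.inter_comm _ (g ⁻¹' {b})]
      rw [tsum_measure_inter_preimage ν hf (hgm b)]
    rw [e1, e2, ← ENNReal.tsum_add, ← ENNReal.tsum_add, partitionEntropy, ← ENNReal.tsum_add]
    refine ENNReal.tsum_le_tsum fun p => ?_
    rw [hpre]
    set r := ν.real (f ⁻¹' {p.1} ∩ g ⁻¹' {p.2}) with hr
    set u := ν.real (f ⁻¹' {p.1}) with hu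
    set v := ν.real (g ⁻¹' {p.2}) with hv
    have hru : r ≤ u := measureReal_mono Set.inter_subset_left
    have hrv : r ≤ v := measureReal_mono Set.inter_subset_right
    have hu1 : u ≤ 1 := measureReal_le_one
    have hv1 : v ≤ 1 := measureReal_le_one
    have hr0 : 0 ≤ r := measureReal_nonneg
    rw [← ofReal_measureReal (μ := ν) (s := f ⁻¹' {p.1} ∩ g ⁻¹' {p.2}),
      ← ofReal_measureReal (μ := ν) (s := f ⁻¹' {p.1}),
      ← ofReal_measureReal (μ := ν) (s := g ⁻¹' {p.2}), ← hr, ← hu, ← hv,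
      ← ENNReal.ofReal_mul hr0, ← ENNReal.ofReal_mul hr0, ← ENNReal.ofReal_mul (hr0.trans hru)]
    have hlu := Real.log_nonpos (hr0.trans hru) hu1
    have hlv := Real.log_nonpos (hr0.trans hrv) hv1
    rw [← ENNReal.ofReal_add (Real.negMulLog_nonneg hr0 (hru.trans hu1)) hr0,
      ← ENNReal.ofReal_add (by nlinarith) (by nlinarith),
      ← ENNReal.ofReal_add (by nlinarith) (by nlinarith)]
    refine ENNReal.ofReal_le_ofReal ?_
    rcases hr0.eq_or_lt with h0 | h0
    · rw [← h0]
      simp only [Real.negMulLog_zero, zero_mul, zero_add]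
      exact mul_nonneg (hr0.trans hru) (hr0.trans hrv)
    · have h1 := negMulLog_le_tangent (mul_pos (h0.trans_le hru) (h0.trans_le hrv)) hr0
      rw [Real.log_mul (h0.trans_le hru).ne' (h0.trans_le hrv).ne'] at h1
      linarith
  have s1 : ∑' p : α × β, ν (f ⁻¹' {p.1} ∩ g ⁻¹' {p.2}) = 1 := by
    rw [ENNReal.tsum_prod', ← tsum_measure_preimage ν hf]
    exact tsum_congr fun a => tsum_measure_inter_preimage ν hg (hfm a)
  have s2 : ∑' p : α × β, ν (f ⁻¹' {p.1}) * ν (g ⁻¹' {p.2}) = 1 := by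
    rw [ENNReal.tsum_prod']
    simp [ENNReal.tsum_mul_left, tsum_measure_preimage ν hg, tsum_measure_preimage ν hf]
  rw [s1, s2] at key
  exact (ENNReal.add_le_add_iff_right ENNReal.one_ne_top).1 key

theorem partitionEntropy_le_add {γ : Type*} [Countable γ] [MeasurableSpace γ]
    [MeasurableSingletonClass γ] {f : Y → γ} {g : Y → α} {h : Y → β} (hf : Measurable f)
    (hg : Measurable g) (hh : Measurable h) (H : ∀ x y, g x = g y → h x = h y → f x = f y) :
    partitionEntropy ν f ≤ partitionEntropy ν g + partitionEntropy ν h :=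
  (partitionEntropy_mono hf (hg.prodMk hh) fun x y hxy =>
    H x y (congrArg Prod.fst hxy) (congrArg Prod.snd hxy)).trans (partitionEntropy_prodMk_le hg hh)

theorem partitionEntropy_le_log_card {f : Y → α} (hf : Measurable f) (T : Finset α)
    (hT : ∀ y, f y ∈ T) : partitionEntropy ν f ≤ ENNReal.ofReal (Real.log T.card) := by
  obtain ⟨y⟩ := nonempty_of_isProbabilityMeasure ν
  have hpos : (0 : ℝ) < T.card := by exact_mod_cast Finset.card_pos.2 ⟨_, hT y⟩
  have hempty : ∀ a ∉ T, f ⁻¹' {a} = ∅ := by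
    intro a ha
    ext x
    simp only [Set.mem_preimage, Set.mem_singleton_iff, Set.mem_empty_iff_false, iff_false]
    rintro rfl
    exact ha (hT x)
  have hsum : ∑ a ∈ T, ν.real (f ⁻¹' {a}) = 1 := by
    have := tsum_measure_preimage ν hf
    rw [tsum_eq_sum (s := T) fun a ha => by rw [hempty a ha, measure_empty]] at this
    simp only [measureReal_def]
    rw [← ENNReal.toReal_sum fun a _ => measure_ne_top _ _, this, ENNReal.toReal_one]
  rw [partitionEntropy, tsum_eq_sum (s := T) fun a ha => by simp [hempty a ha],
    ← ENNReal.ofReal_sum_of_nonneg fun a _ =>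
      Real.negMulLog_nonneg measureReal_nonneg measureReal_le_one]
  refine ENNReal.ofReal_le_ofReal ?_
  calc ∑ a ∈ T, Real.negMulLog (ν.real (f ⁻¹' {a}))
      ≤ ∑ a ∈ T, ((T.card : ℝ)⁻¹ - ν.real (f ⁻¹' {a}) -
          ν.real (f ⁻¹' {a}) * Real.log (T.card : ℝ)⁻¹) :=
        Finset.sum_le_sum fun a _ => negMulLog_le_tangent (inv_pos.2 hpos) measureReal_nonneg
    _ = Real.log T.card := by
        rw [Finset.sum_sub_distrib, Finset.sum_sub_distrib, ← Finset.sum_mul, hsum,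
          Finset.sum_const, nsmul_eq_mul, mul_inv_cancel₀ hpos.ne', Real.log_inv]
        ring

/-- The join of a finite family of partitions, labelled by the natural numbers. -/
theorem exists_join_partition {ι : Type*} (s : Finset ι) (h : ι → Y → α)
    (hh : ∀ i, Measurable (h i)) :
    ∃ g : Y → ℕ, Measurable g ∧ partitionEntropy ν g ≤ ∑ i ∈ s, partitionEntropy ν (h i) ∧
      ∀ x y, g x = g y → ∀ i ∈ s, h i x = h i y := by
  classical
  obtain ⟨e, he⟩ := Countable.exists_injective_nat α
  induction s using Finset.induction_on with
  | empty =>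
    refine ⟨fun _ => 0, measurable_const, ?_, by simp⟩
    exact (partitionEntropy_le_log_card measurable_const {0} (by simp)).trans (by simp)
  | insert i s hi ih =>
    obtain ⟨g, hg, hle, hdet⟩ := ih
    have hm : Measurable fun y => Nat.pair (e (h i y)) (g y) :=
      (Measurable.of_discrete (f := fun p : α × ℕ => Nat.pair (e p.1) p.2)).comp
        ((hh i).prodMk hg)
    refine ⟨_, hm, ?_, fun x y hxy j hj => ?_⟩
    · rw [Finset.sum_insert hi]
      refine (partitionEntropy_le_add hm (hh i) hg fun x y h1 h2 => ?_).trans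
        (add_le_add_right hle _)
      simp only [h1, h2]
    · obtain ⟨h1, h2⟩ := Nat.pair_eq_pair.1 hxy
      rcases Finset.mem_insert.1 hj with rfl | hj
      · exact he h1
      · exact hdet x y h2 j hj

end Shannon

theorem partitionEntropy_comp_smul {G Y α : Type*} [MeasurableSpace Y] {ν : Measure Y}
    [Countable α] [Group G] [MulAction G Y] [MeasurableConstSMul G Y] [SMulInvariantMeasure G Y ν]
    (c : G) (f : Y → α) :
    partitionEntropy ν (fun y => f (c • y)) = partitionEntropy ν f := by
  simp only [partitionEntropy, measureReal_def]
  refine tsum_congr fun a => ?_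
  rw [← measure_preimage_smul ν c (f ⁻¹' {a})]
  rfl

/-! ### Partition entropy from covers by sets of small average diameter -/

section SmallCover

theorem lt_of_semiDiam_lt {Y : Type*} {ρ : Y → Y → ℝ} {A : Set Y} {ε : ℝ}
    (h : semiDiam ρ A < ENNReal.ofReal ε) {x y : Y} (hx : x ∈ A) (hy : y ∈ A) : ρ x y < ε := by
  have h1 : ENNReal.ofReal (ρ x y) ≤ semiDiam ρ A :=
    le_iSup₂_of_le x hx (le_iSup₂_of_le y hy le_rfl)
  by_contra! hle
  exact absurd (h1.trans_lt h) (not_lt.2 (ENNReal.ofReal_le_ofReal hle))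

variable {Y : Type*} [MeasurableSpace Y] {ν : Measure Y}

open scoped Classical in
/-- A small cover gives a measurable labelling with `k` labels such that, off a small set, every
point is close to the chosen representative of its label. -/
theorem HasSmallCover.exists_labelling [Nonempty Y] {ρ : Y → Y → ℝ} {ε : ℝ} {k : ℕ}
    (hk : 0 < k) (h : HasSmallCover ν ρ ε k) :
    ∃ (N : Y → ℕ) (r : ℕ → Y) (B : Set Y), Measurable N ∧ (∀ y, N y < k) ∧ MeasurableSet B ∧
      ν B < ENNReal.ofReal ε ∧ ∀ y ∉ B, ρ y (r (N y)) < ε := by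
  obtain ⟨A, hAm, hAcov, hA0, hA⟩ := h
  -- Label `j` stands for `A (j + 1)`. The default `k - 1` keeps the labels of points of `A 0` below
  -- `k`; a point outside `A 0` that reaches it lies in no earlier set, hence in `A k`.
  let p : Y → ℕ → Prop := fun y j => j = k - 1 ∨ ∃ hj : j + 1 < k + 1, y ∈ A ⟨j + 1, hj⟩
  have hp : ∀ y, ∃ j, p y j := fun y => ⟨k - 1, Or.inl rfl⟩
  have hlt : ∀ y, Nat.find (hp y) < k := by
    intro y
    have : Nat.find (hp y) ≤ k - 1 := Nat.find_min' (hp y) (Or.inl rfl)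
    omega
  have hmem : ∀ y, ∀ hy : y ∉ A 0,
      y ∈ A ⟨Nat.find (hp y) + 1, Nat.succ_lt_succ (hlt y)⟩ := by
    intro y hy
    obtain ⟨i, hi⟩ := Set.mem_iUnion.1 (hAcov ▸ Set.mem_univ y)
    have hi0 : i ≠ 0 := by rintro rfl; exact hy hi
    obtain ⟨i', rfl⟩ := Fin.exists_succ_eq.2 hi0
    have hle : Nat.find (hp y) ≤ i' :=
      Nat.find_min' (hp y) (Or.inr ⟨Nat.succ_lt_succ i'.2, hi⟩)
    rcases Nat.find_spec (hp y) with h | ⟨hj, h⟩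
    · have : Nat.find (hp y) = i' := by omega
      convert hi using 2
      ext
      simpa using this
    · exact h
  have hm : Measurable fun y => Nat.find (hp y) := by
    refine measurable_find hp fun j => ?_
    by_cases hj : j + 1 < k + 1
    · by_cases hjk : j = k - 1
      · simp [p, hjk]
      · have : {y | p y j} = A ⟨j + 1, hj⟩ := by
          ext y
          simp [p, hjk, Nat.lt_of_succ_lt_succ hj]
        rw [this]
        exact hAm _
    · have : {y | p y j} = {y | j = k - 1} := by
        ext y
        simp only [p, hj, IsEmpty.exists_iff, or_false]
      rw [this]
      exact MeasurableSet.const _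
  refine ⟨fun y => Nat.find (hp y), fun j => if h : ∃ y ∉ A 0, Nat.find (hp y) = j then h.choose
    else Classical.arbitrary Y, A 0, hm, hlt, hAm 0, hA0, fun y hy => ?_⟩
  have hex : ∃ z ∉ A 0, Nat.find (hp z) = Nat.find (hp y) := ⟨y, hy, rfl⟩
  beta_reduce
  rw [dif_pos hex]
  obtain ⟨hz, hzy⟩ := hex.choose_spec
  have h1 := hmem _ hz
  have h2 := hmem y hy
  refine lt_of_semiDiam_lt (hA ⟨Nat.find (hp y) + 1, Nat.succ_lt_succ (hlt y)⟩
    (by simp [Fin.ext_iff])) h2 ?_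
  convert h1 using 3
  exact congrArg (· + 1) hzy.symm

/-- The entropy of a partition with one dominant cell, labelled by `0`. -/
theorem partitionEntropy_le_of_dominant_cell [IsProbabilityMeasure ν] {ω : Y → ℕ}
    (hω : Measurable ω) {p : ℕ → ℝ} (hp : ∀ a, ν.real (ω ⁻¹' {a + 1}) ≤ p a) (hp1 : ∀ a, p a ≤ 1)
    (T : Finset ℕ) {s : ℝ} (hs : 0 < s) (hs1 : s ≤ 1) :
    partitionEntropy ν ω ≤ ν {y | ω y ≠ 0} * (1 + ENNReal.ofReal (-Real.log s)) +
      (T.card * ENNReal.ofReal s + ∑' a : ((T : Set ℕ)ᶜ : Set ℕ),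
        (ENNReal.ofReal (p a) + ENNReal.ofReal (Real.negMulLog (p a)))) := by
  classical
  have hne : MeasurableSet {y | ω y ≠ 0} := (hω (measurableSet_singleton 0)).compl
  have hsum : ∑' a, ν (ω ⁻¹' {a + 1}) = ν {y | ω y ≠ 0} := by
    have h0 : {y | ω y ≠ 0} ∩ ω ⁻¹' {0} = ∅ := by ext; simp
    rw [← tsum_measure_inter_preimage ν hω hne,
      tsum_eq_zero_add' (f := fun b => ν ({y | ω y ≠ 0} ∩ ω ⁻¹' {b})) ENNReal.summable, h0,
      measure_empty, zero_add]
    refine tsum_congr fun a => congrArg ν ?_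
    ext y
    simp only [Set.mem_inter_iff, Set.mem_preimage, Set.mem_singleton_iff, Set.mem_ofPred_eq]
    omega
  have hzero : ENNReal.ofReal (Real.negMulLog (ν.real (ω ⁻¹' {0}))) ≤ ν {y | ω y ≠ 0} := by
    have h1 := negMulLog_le_tangent one_pos (measureReal_nonneg (μ := ν) (s := ω ⁻¹' {0}))
    have h2 : ν.real {y | ω y ≠ 0} = 1 - ν.real (ω ⁻¹' {0}) :=
      probReal_compl_eq_one_sub (hω (measurableSet_singleton 0))
    rw [← ofReal_measureReal (μ := ν) (s := {y | ω y ≠ 0})]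
    refine ENNReal.ofReal_le_ofReal ?_
    rw [h2]
    simpa using h1
  -- Cells in `T` are bounded by the tangent at the threshold `s`, the others by the tail of `p`.
  have hpoint : ∀ a, ENNReal.ofReal (Real.negMulLog (ν.real (ω ⁻¹' {a + 1}))) ≤
      ν (ω ⁻¹' {a + 1}) * ENNReal.ofReal (-Real.log s) +
      ((if a ∈ T then ENNReal.ofReal s else 0) + ((T : Set ℕ)ᶜ).indicator
        (fun a => ENNReal.ofReal (p a) + ENNReal.ofReal (Real.negMulLog (p a))) a) := by
    intro a
    have hq0 := measureReal_nonneg (μ := ν) (s := ω ⁻¹' {a + 1})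
    have hls := Real.log_nonpos hs.le hs1
    by_cases ha : a ∈ T
    · rw [if_pos ha, Set.indicator_of_notMem (by simpa using ha), add_zero,
        ← ofReal_measureReal (μ := ν) (s := ω ⁻¹' {a + 1}), ← ENNReal.ofReal_mul hq0,
        ← ENNReal.ofReal_add (mul_nonneg hq0 (by linarith)) hs.le]
      refine ENNReal.ofReal_le_ofReal ?_
      have := negMulLog_le_tangent hs hq0
      linarith
    · rw [if_neg ha, Set.indicator_of_mem (by simpa using ha), zero_add]
      refine le_add_left ?_
      rw [← ENNReal.ofReal_add (hq0.trans (hp a))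
        (Real.negMulLog_nonneg (hq0.trans (hp a)) (hp1 a))]
      exact ENNReal.ofReal_le_ofReal (negMulLog_le_add_of_le hq0 (hp a) (hp1 a))
  rw [partitionEntropy, tsum_eq_zero_add' ENNReal.summable, mul_add, mul_one, add_assoc]
  refine add_le_add hzero ((ENNReal.tsum_le_tsum hpoint).trans (le_of_eq ?_))
  rw [ENNReal.tsum_add, ENNReal.tsum_add, ENNReal.tsum_mul_right, hsum, tsum_subtype
    ((T : Set ℕ)ᶜ) (fun a => ENNReal.ofReal (p a) + ENNReal.ofReal (Real.negMulLog (p a))),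
    tsum_eq_sum (s := T) (fun a ha => if_neg ha), Finset.sum_ite_mem, Finset.inter_self,
    Finset.sum_const, nsmul_eq_mul]

variable {G : Type*} [Group G] [MulAction G Y] [MeasurableConstSMul G Y]

theorem measurable_refine (S : Finset G) {ξ : Y → ℕ} (hξ : Measurable ξ) :
    Measurable (refine S ξ) :=
  measurable_pi_lambda _ fun g => hξ.comp (measurable_const_smul (g : G))

-- The name of `y` along `W` is recovered from the label `N y` and the corrections `ω g y`, where
-- `0` means agreement with the representative of the label. Since `ρ` is at least 1 across cells of
-- `ξ`, a small average distance leaves few nonzero corrections; and the cell `a + 1` of `ω g` lies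
-- in a shift of the cell `a` of `ξ`, which controls the tail.
open scoped Classical in
theorem partitionEntropy_refine_le_of_smallCover [IsProbabilityMeasure ν]
    [SMulInvariantMeasure G Y ν] {W : Finset G} {ξ : Y → ℕ} (hξ : Measurable ξ)
    {ρ : Y → Y → ℝ} (hρ0 : ∀ x y, 0 ≤ ρ x y) (hρ1 : ∀ x y, ξ x ≠ ξ y → 1 ≤ ρ x y) {ε : ℝ} {k : ℕ}
    (hk : 0 < k) (hcov : HasSmallCover ν (avgSemimetric W ρ) ε k) (T : Finset ℕ) {s : ℝ}
    (hs : 0 < s) (hs1 : s ≤ 1) :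
    partitionEntropy ν (refine W ξ) ≤ ENNReal.ofReal (Real.log k) +
      W.card * (2 * ENNReal.ofReal ε * (1 + ENNReal.ofReal (-Real.log s)) +
      (T.card * ENNReal.ofReal s + ∑' a : ((T : Set ℕ)ᶜ : Set ℕ),
        (ENNReal.ofReal (ν.real (ξ ⁻¹' {(a : ℕ)})) +
          ENNReal.ofReal (Real.negMulLog (ν.real (ξ ⁻¹' {(a : ℕ)})))))) := by
  have : Nonempty Y := nonempty_of_isProbabilityMeasure ν
  obtain ⟨N, r, B, hN, hNk, hBm, hB, hr⟩ := hcov.exists_labelling hk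
  let ω : G → Y → ℕ := fun g y => if ξ (g • y) = ξ (g • r (N y)) then 0 else ξ (g • y) + 1
  have hωm : ∀ g, Measurable (ω g) := fun g =>
    (Measurable.of_discrete
      (f := fun q : ℕ × ℕ => if q.1 = ξ (g • r q.2) then 0 else q.1 + 1)).comp
      ((hξ.comp (measurable_const_smul g)).prodMk hN)
  obtain ⟨J, hJm, hJle, hJ⟩ := exists_join_partition (ν := ν) W ω hωm
  have hcount : ∀ y ∉ B, ((W.filter fun g => ω g y ≠ 0).card : ℝ) ≤ W.card * ε := by
    intro y hy
    have h1 := hr y hy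
    rcases W.eq_empty_or_nonempty with rfl | hW
    · simp
    have hWpos : (0 : ℝ) < W.card := by exact_mod_cast hW.card_pos
    rw [avgSemimetric, div_lt_iff₀ hWpos] at h1
    calc ((W.filter fun g => ω g y ≠ 0).card : ℝ)
        = ∑ g ∈ W, if ω g y ≠ 0 then (1 : ℝ) else 0 :=
          Finset.natCast_card_filter _ _
      _ ≤ ∑ g ∈ W, ρ (g • y) (g • r (N y)) := by
        refine Finset.sum_le_sum fun g _ => ?_
        split_ifs with h
        · refine hρ1 _ _ fun heq => h ?_
          simp [ω, heq]
        · exact hρ0 _ _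
      _ ≤ W.card * ε := by linarith
  -- One `ε` comes from the points off `B`, where at most `ε * |W|` corrections are nonzero, the
  -- other from `ν B < ε`.
  have hmass : ∑ g ∈ W, ν {y | ω g y ≠ 0} ≤ W.card * (2 * ENNReal.ofReal ε) := by
    have hms : ∀ g, MeasurableSet {y | ω g y ≠ 0} :=
      fun g => ((hωm g) (measurableSet_singleton 0)).compl
    calc ∑ g ∈ W, ν {y | ω g y ≠ 0}
        = ∫⁻ y, ∑ g ∈ W, ({y | ω g y ≠ 0} : Set Y).indicator 1 y ∂ν := by
          rw [lintegral_finsetSum _ fun g _ => measurable_one.indicator (hms g)]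
          exact Finset.sum_congr rfl fun g _ => (lintegral_indicator_one (hms g)).symm
      _ ≤ ∫⁻ y, (W.card * ENNReal.ofReal ε + W.card * B.indicator 1 y) ∂ν := by
          refine lintegral_mono fun y => ?_
          have hsum : ∑ g ∈ W, ({y | ω g y ≠ 0} : Set Y).indicator (1 : Y → ℝ≥0∞) y =
              ((W.filter fun g => ω g y ≠ 0).card : ℝ≥0∞) := by
            rw [Finset.natCast_card_filter]
            exact Finset.sum_congr rfl fun g _ => by simp only [Set.indicator_apply]; rfl
          rw [hsum]
          by_cases hy : y ∈ B
          · refine le_add_left ?_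
            rw [Set.indicator_of_mem hy, Pi.one_apply, mul_one]
            exact_mod_cast Finset.card_filter_le _ _
          · refine le_add_right ?_
            rw [← ENNReal.ofReal_natCast, ← ENNReal.ofReal_natCast (W.card),
              ← ENNReal.ofReal_mul (Nat.cast_nonneg _)]
            exact ENNReal.ofReal_le_ofReal (hcount y hy)
      _ = W.card * ENNReal.ofReal ε + W.card * ν B := by
          rw [lintegral_add_left measurable_const, lintegral_const, measure_univ, mul_one,
            lintegral_const_mul _ (measurable_one.indicator hBm), lintegral_indicator_one hBm]
      _ ≤ W.card * (2 * ENNReal.ofReal ε) := by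
          rw [two_mul, mul_add]
          gcongr
  have hNe : partitionEntropy ν N ≤ ENNReal.ofReal (Real.log k) := by
    simpa using partitionEntropy_le_log_card (ν := ν) hN (Finset.range k)
      fun y => Finset.mem_range.2 (hNk y)
  have hωe : ∀ g, partitionEntropy ν (ω g) ≤
      ν {y | ω g y ≠ 0} * (1 + ENNReal.ofReal (-Real.log s)) +
      (T.card * ENNReal.ofReal s + ∑' a : ((T : Set ℕ)ᶜ : Set ℕ),
        (ENNReal.ofReal (ν.real (ξ ⁻¹' {(a : ℕ)})) +
          ENNReal.ofReal (Real.negMulLog (ν.real (ξ ⁻¹' {(a : ℕ)}))))) := by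
    intro g
    refine partitionEntropy_le_of_dominant_cell (hωm g) (p := fun a => ν.real (ξ ⁻¹' {a}))
      (fun a => ?_) (fun a => measureReal_le_one) T hs hs1
    have hinv : ν.real ((fun y => g • y) ⁻¹' (ξ ⁻¹' {a})) = ν.real (ξ ⁻¹' {a}) := by
      rw [measureReal_def, measure_preimage_smul, measureReal_def]
    rw [← hinv]
    refine measureReal_mono fun y hy => ?_
    simp only [ω, Set.mem_preimage, Set.mem_singleton_iff] at hy ⊢
    split_ifs at hy
    omega
  calc partitionEntropy ν (refine W ξ)
      ≤ partitionEntropy ν N + partitionEntropy ν J := by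
        refine partitionEntropy_le_add (measurable_refine W hξ) hN hJm fun x y h1 h2 => ?_
        funext g
        have h3 := hJ x y h2 g g.2
        simp only [ω, h1] at h3
        simp only [refine]
        split_ifs at h3 with h4 h5 h5
        · rw [h4, h5]
        · omega
    _ ≤ ENNReal.ofReal (Real.log k) + ∑ g ∈ W, partitionEntropy ν (ω g) := add_le_add hNe hJle
    _ ≤ _ := by
        refine add_le_add_right ((Finset.sum_le_sum fun g _ => hωe g).trans ?_) _
        rw [Finset.sum_add_distrib, ← Finset.sum_mul, Finset.sum_const, nsmul_eq_mul,
          mul_add (W.card : ℝ≥0∞) (2 * _ * _), ← mul_assoc]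
        gcongr

end SmallCover

/-! ### Slow growth of the scaling entropy forces zero measure entropy -/

section ZeroEntropy

theorem tendsto_const_mul_ofReal_nhdsGT_zero {c : ℝ≥0∞} (hc : c ≠ ∞) :
    Tendsto (fun s : ℝ => c * ENNReal.ofReal s) (𝓝[>] 0) (𝓝 0) := by
  have h1 : Tendsto (fun s : ℝ => ENNReal.ofReal s) (𝓝[>] 0) (𝓝 0) := by
    have := (ENNReal.continuous_ofReal.tendsto 0).mono_left (nhdsWithin_le_nhds (s := Set.Ioi 0))
    rwa [ENNReal.ofReal_zero] at this
  simpa using ENNReal.Tendsto.const_mul h1 (Or.inr hc)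

theorem exists_mem_Ioo_const_mul_ofReal_le {c η : ℝ≥0∞} (hc : c ≠ ∞) (hη : 0 < η) {b : ℝ}
    (hb : 0 < b) : ∃ s ∈ Set.Ioo 0 b, c * ENNReal.ofReal s ≤ η := by
  have h : ∀ᶠ s in 𝓝[>] (0 : ℝ), s ∈ Set.Ioo 0 b := Ioo_mem_nhdsGT hb
  exact (h.and (ENNReal.tendsto_nhds_zero.1 (tendsto_const_mul_ofReal_nhdsGT_zero hc) η hη)).exists

variable {G : Type*} [Group G] {Y : Type*} [MeasurableSpace Y] [MulAction G Y]
  [MeasurableConstSMul G Y] {ν : Measure Y} [IsProbabilityMeasure ν] [SMulInvariantMeasure G Y ν]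

theorem tendsto_partitionEntropy_refine_div_card {W : ℕ → Finset G} (hW : ∀ n, (W n).Nonempty)
    {ξ : Y → ℕ} (hξ : Measurable ξ) (hH : partitionEntropy ν ξ < ∞) {ρ : Y → Y → ℝ}
    (hρ0 : ∀ x y, 0 ≤ ρ x y) (hρ1 : ∀ x y, ξ x ≠ ξ y → 1 ≤ ρ x y) {ε₀ : ℝ} (hε₀ : 0 < ε₀)
    (hlim : ∀ ε, 0 < ε → ε < ε₀ → Tendsto
      (fun n => epsEntropy ν (avgSemimetric (W n) ρ) ε / ((W n).card : ℝ≥0∞)) atTop (𝓝 0)) :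
    Tendsto (fun n => partitionEntropy ν (refine (W n) ξ) / ((W n).card : ℝ≥0∞))
      atTop (𝓝 0) := by
  rw [ENNReal.tendsto_nhds_zero]
  intro η hη
  have hη4 : 0 < η / 2 / 2 := ENNReal.half_pos (ENNReal.half_pos hη.ne').ne'
  have hfin : ∑' a, (ENNReal.ofReal (ν.real (ξ ⁻¹' {a})) +
      ENNReal.ofReal (Real.negMulLog (ν.real (ξ ⁻¹' {a})))) ≠ ∞ := by
    rw [ENNReal.tsum_add]
    have hreal : ∀ a, ENNReal.ofReal (ν.real (ξ ⁻¹' {a})) = ν (ξ ⁻¹' {a}) :=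
      fun a => ofReal_measureReal
    simp only [hreal]
    rw [tsum_measure_preimage ν hξ]
    exact ENNReal.add_ne_top.2 ⟨ENNReal.one_ne_top, hH.ne⟩
  -- The order of choice matters: `T` makes the tail small, `s` depends on `|T|`, and `ε` must beat
  -- `-log s`. Each error gets a quarter of `η`.
  obtain ⟨T, hT⟩ := (ENNReal.tendsto_nhds_zero.1
    (ENNReal.tendsto_tsum_compl_atTop_zero hfin) _ hη4).exists
  obtain ⟨s, ⟨hs, hs1⟩, hTs⟩ := exists_mem_Ioo_const_mul_ofReal_le
    (ENNReal.natCast_ne_top T.card) hη4 one_pos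
  obtain ⟨ε, ⟨hε, hεε₀⟩, hεs⟩ := exists_mem_Ioo_const_mul_ofReal_le
    (c := 2 * (1 + ENNReal.ofReal (-Real.log s))) (by finiteness) hη4 hε₀
  filter_upwards [(hlim ε hε hεε₀).eventually_lt_const hη4] with n hn
  have hcard : ((W n).card : ℝ≥0∞) ≠ 0 := by exact_mod_cast (hW n).card_pos.ne'
  rw [ENNReal.div_lt_iff (Or.inl hcard) (Or.inl (ENNReal.natCast_ne_top _))] at hn
  obtain ⟨k, hk⟩ := iInf_lt_iff.1 hn
  obtain ⟨⟨hk0, hcov⟩, hk⟩ := iInf_lt_iff.1 hk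
  have hlog : ENNReal.ofReal (Real.log k) ≤ η / 2 / 2 * (W n).card := by
    refine (ENNReal.ofReal_le_ofReal ?_).trans hk.le
    have hk1 : (1 : ℝ) ≤ k := by exact_mod_cast hk0
    have h2 : Real.log 2 ≤ 1 := by linarith [Real.log_two_lt_d9]
    rw [Real.logb, le_div_iff₀ (Real.log_pos one_lt_two)]
    exact mul_le_of_le_one_right (Real.log_nonneg hk1) h2
  refine ENNReal.div_le_of_le_mul
    ((partitionEntropy_refine_le_of_smallCover hξ hρ0 hρ1 hk0 hcov T hs hs1.le).trans ?_)
  calc _ ≤ η / 2 / 2 * (W n).card + (W n).card * (η / 2 / 2 + (η / 2 / 2 + η / 2 / 2)) := by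
        refine add_le_add hlog (mul_le_mul_right (add_le_add ?_ (add_le_add hTs hT)) _)
        rwa [mul_right_comm]
    _ = (η / 2 / 2 + η / 2 / 2 + (η / 2 / 2 + η / 2 / 2)) * (W n).card := by ring
    _ = η * (W n).card := by rw [ENNReal.add_halves, ENNReal.add_halves]

/-- Passage from `W` to `F`: translates of one fixed `W m` cover most of `F n`, each costs the
entropy of `refine (W m) ξ` by invariance, and each leftover element costs that of `ξ`. -/
theorem dynamicalPartitionEntropy_eq_zero {F W : ℕ → Finset G} (hF : IsLeftFolner F)
    (hW : ∀ n, (W n).Nonempty) {ξ : Y → ℕ} (hξ : Measurable ξ) (hH : partitionEntropy ν ξ < ∞)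
    (hlim : Tendsto (fun n => partitionEntropy ν (refine (W n) ξ) / ((W n).card : ℝ≥0∞))
      atTop (𝓝 0)) : dynamicalPartitionEntropy ν F ξ = 0 := by
  have key : ∀ δ : ℝ, 0 < δ →
      dynamicalPartitionEntropy ν F ξ ≤ (1 + partitionEntropy ν ξ) * ENNReal.ofReal δ := by
    intro δ hδ
    have hlim' := ENNReal.Tendsto.const_mul hlim (Or.inr (ENNReal.ofReal_ne_top (r := 2 / δ)))
    rw [mul_zero] at hlim'
    -- Chosen after `δ`, so that the rate along `W m` absorbs the covering multiplicity `2 / δ`.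
    obtain ⟨m, hm⟩ := (ENNReal.tendsto_nhds_zero.1 hlim' _ (ENNReal.ofReal_pos.2 hδ)).exists
    refine limsup_le_of_le (by isBoundedDefault) ?_
    filter_upwards [hF.exists_translate_cover hδ (hW m)] with n hn
    obtain ⟨C, V, hC, hV, hcov⟩ := hn
    have hcard : ((W m).card : ℝ≥0∞) ≠ 0 := by exact_mod_cast (hW m).card_pos.ne'
    have hC' : ((W m).card : ℝ≥0∞) * C.card ≤ ENNReal.ofReal (2 / δ) * (F n).card := by
      simp only [← ENNReal.ofReal_natCast]
      rw [← ENNReal.ofReal_mul (Nat.cast_nonneg _), ← ENNReal.ofReal_mul (by positivity)]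
      exact ENNReal.ofReal_le_ofReal hC
    have hV' : (V.card : ℝ≥0∞) ≤ ENNReal.ofReal δ * (F n).card := by
      simp only [← ENNReal.ofReal_natCast]
      rw [← ENNReal.ofReal_mul hδ.le]
      exact ENNReal.ofReal_le_ofReal hV
    obtain ⟨J₁, hJ₁m, hJ₁le, hJ₁⟩ := exists_join_partition (ν := ν) C
      (fun c y => refine (W m) ξ (c • y))
      (fun c => (measurable_refine (W m) hξ).comp (measurable_const_smul c))
    obtain ⟨J₂, hJ₂m, hJ₂le, hJ₂⟩ := exists_join_partition (ν := ν) V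
      (fun v y => ξ (v • y)) (fun v => hξ.comp (measurable_const_smul v))
    simp only [partitionEntropy_comp_smul _ ξ, partitionEntropy_comp_smul _ (refine (W m) ξ),
      Finset.sum_const, nsmul_eq_mul] at hJ₁le hJ₂le
    refine ENNReal.div_le_of_le_mul ?_
    calc partitionEntropy ν (refine (F n) ξ)
        ≤ partitionEntropy ν J₁ + partitionEntropy ν J₂ := by
          refine partitionEntropy_le_add (measurable_refine _ hξ) hJ₁m hJ₂m fun x y h1 h2 => ?_
          funext g
          rcases hcov g g.2 with h | ⟨c, hc, t, ht, h⟩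
          · exact hJ₂ x y h2 g h
          · have := congrFun (hJ₁ x y h1 c hc) ⟨t, ht⟩
            simpa only [refine, smul_smul, ← h] using this
      _ ≤ C.card * partitionEntropy ν (refine (W m) ξ) + V.card * partitionEntropy ν ξ :=
          add_le_add hJ₁le hJ₂le
      _ = ((W m).card * C.card) * (partitionEntropy ν (refine (W m) ξ) / (W m).card) +
            V.card * partitionEntropy ν ξ := by
          rw [mul_right_comm, mul_comm (_ * _) (C.card : ℝ≥0∞),
            ENNReal.mul_div_cancel hcard (ENNReal.natCast_ne_top _)]
      _ ≤ (ENNReal.ofReal (2 / δ) * (F n).card) *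
            (partitionEntropy ν (refine (W m) ξ) / (W m).card) +
            ENNReal.ofReal δ * (F n).card * partitionEntropy ν ξ := by gcongr
      _ = (ENNReal.ofReal (2 / δ) * (partitionEntropy ν (refine (W m) ξ) / (W m).card)) *
            (F n).card + ENNReal.ofReal δ * (F n).card * partitionEntropy ν ξ := by ring
      _ ≤ ENNReal.ofReal δ * (F n).card + ENNReal.ofReal δ * (F n).card * partitionEntropy ν ξ := by
          gcongr
      _ = (1 + partitionEntropy ν ξ) * ENNReal.ofReal δ * (F n).card := by ring
  refine le_antisymm (ge_of_tendsto (tendsto_const_mul_ofReal_nhdsGT_zero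
    (c := 1 + partitionEntropy ν ξ) (by finiteness)) ?_) zero_le
  filter_upwards [self_mem_nhdsWithin] with δ hδ using key δ hδ

end ZeroEntropy

/-! ### Semimetrics adapted to a partition -/

section Semimetrics

theorem HasSmallCover.mono {Y : Type*} [MeasurableSpace Y] {ν : Measure Y} {ρ : Y → Y → ℝ}
    {ε ε' : ℝ} {k : ℕ} (h : HasSmallCover ν ρ ε k) (hε : ε ≤ ε') : HasSmallCover ν ρ ε' k := by
  obtain ⟨A, hAm, hAcov, hA0, hA⟩ := h
  have hle := ENNReal.ofReal_le_ofReal hε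
  exact ⟨A, hAm, hAcov, hA0.trans_le hle, fun i hi => (hA i hi).trans_le hle⟩

theorem antitone_epsEntropy {Y : Type*} [MeasurableSpace Y] (ν : Measure Y) (ρ : Y → Y → ℝ) :
    Antitone (epsEntropy ν ρ) := fun _ _ hε =>
  le_iInf₂ fun k hk => iInf₂_le k ⟨hk.1, hk.2.mono hε⟩

theorem Preceq.refl (Φ : ℕ → ℝ → ℝ≥0∞) : Preceq Φ Φ :=
  fun ε hε => ⟨ε, hε, 1, one_pos, fun n => by simp⟩

theorem epsEntropy_mem_scalingEntropy {G : Type*} [Group G] {Y : Type*} [MeasurableSpace Y]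
    [MulAction G Y] {ν : Measure Y} {W : ℕ → Finset G} {ρ : Y → Y → ℝ}
    (h1 : IsSummableSemimetric ν ρ) (h2 : IsAdmissible ν ρ) (h3 : IsGenerating ν W ρ) :
    (fun n ε => epsEntropy ν (avgSemimetric (W n) ρ) ε) ∈ scalingEntropy ν W :=
  ⟨fun n => (antitone_epsEntropy ν (avgSemimetric (W n) ρ)).antitoneOn _, ρ, h1, h2, h3,
    Preceq.refl _, Preceq.refl _⟩

/-- A semimetric that is uniformly continuous with respect to a map to a separable metric space
is admissible. -/
theorem isAdmissible_of_map {Y Z : Type*} [MeasurableSpace Y] (ν : Measure Y)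
    [PseudoMetricSpace Z] [SecondCountableTopology Z] (h : Y → Z) {ρ : Y → Y → ℝ}
    (hρ : ∀ ε : ℝ, 0 < ε → ∃ δ : ℝ, 0 < δ ∧ ∀ x y, dist (h x) (h y) < δ → ρ x y < ε) :
    IsAdmissible ν ρ := by
  obtain ⟨s, hs, hd⟩ := TopologicalSpace.exists_countable_dense (Set.range h)
  refine ⟨Set.univ, by simp, (fun z => z.2.choose) '' s, Set.subset_univ _, hs.image _,
    fun x _ ε hε => ?_⟩
  obtain ⟨δ, hδ, hρδ⟩ := hρ ε hε
  obtain ⟨z, hz, hxz⟩ := hd.exists_dist_lt ⟨h x, x, rfl⟩ hδ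
  refine ⟨_, Set.mem_image_of_mem _ hz, hρδ _ _ ?_⟩
  rw [z.2.choose_spec]
  exact hxz

/-- If the scaling entropy grows slower than the cardinality of the equipment, then the measure
entropy vanishes. -/
theorem measureEntropy_eq_zero_of_scalingEntropy {G : Type*} [Group G] {Y : Type*}
    [MeasurableSpace Y] [StandardBorelSpace Y] [MulAction G Y] [MeasurableConstSMul G Y]
    {ν : Measure Y} [IsProbabilityMeasure ν] [SMulInvariantMeasure G Y ν]
    {F W : ℕ → Finset G} (hF : IsLeftFolner F) (hW : ∀ n, (W n).Nonempty)
    (h : ∀ Φ ∈ scalingEntropy ν W, ∃ ε₀ : ℝ, 0 < ε₀ ∧ ∀ ε : ℝ, 0 < ε → ε < ε₀ →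
      Tendsto (fun n => Φ n ε / ((W n).card : ℝ≥0∞)) atTop (𝓝 0)) :
    measureEntropy ν F = 0 := by
  simp only [measureEntropy, ENNReal.iSup_eq_zero]
  intro ξ hξ hH
  have hemb := measurableEmbedding_sigmoid_comp_embeddingReal Y
  let e : Y → ℝ := fun y => (unitInterval.sigmoid (embeddingReal Y y) : ℝ)
  have he : Measurable e := measurable_subtype_coe.comp hemb.measurable
  have hinj : Function.Injective e := Subtype.val_injective.comp hemb.injective
  -- The first term, bounded thanks to the sigmoid, separates points and makes `ρ` generating; the
  -- second detects `ξ`.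
  let ρ : Y → Y → ℝ := fun x y => |e x - e y| + if ξ x = ξ y then 0 else 1
  have hρ0 : ∀ x y, 0 ≤ ρ x y := fun x y => add_nonneg (abs_nonneg _) (by split_ifs <;> simp)
  have hρ1 : ∀ x y, ξ x ≠ ξ y → 1 ≤ ρ x y := fun x y hxy => by simp [ρ, hxy]
  have hbound : ∀ x y, ρ x y ≤ 2 := by
    intro x y
    have h1 : |e x - e y| ≤ 1 := abs_sub_le_of_le_of_le
      (unitInterval.sigmoid _).2.1 (unitInterval.sigmoid _).2.2
      (unitInterval.sigmoid _).2.1 (unitInterval.sigmoid _).2.2 |>.trans (by simp)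
    have h2 : (if ξ x = ξ y then (0 : ℝ) else 1) ≤ 1 := by split_ifs <;> simp
    simp only [ρ]
    linarith
  have hmeas : Measurable fun p : Y × Y => ρ p.1 p.2 := by
    refine Measurable.add ?_ (Measurable.ite ?_ measurable_const measurable_const)
    · exact ((he.comp measurable_fst).sub (he.comp measurable_snd)).abs
    · exact measurableSet_eq_fun (hξ.comp measurable_fst) (hξ.comp measurable_snd)
  have hsm : IsSummableSemimetric ν ρ := by
    refine ⟨fun x => by simp [ρ], hρ0, fun x y => ?_, fun x y z => ?_, ?_⟩
    · simp only [ρ, abs_sub_comm (e x), eq_comm (a := ξ x)]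
    · have h1 := abs_sub_le (e x) (e y) (e z)
      have h2 : (if ξ x = ξ z then (0 : ℝ) else 1) ≤
          (if ξ x = ξ y then 0 else 1) + if ξ y = ξ z then 0 else 1 := by
        split_ifs <;> simp_all
      simp only [ρ]
      linarith
    · refine Integrable.of_bound hmeas.aestronglyMeasurable 2 (ae_of_all _ fun p => ?_)
      rw [Real.norm_of_nonneg (hρ0 _ _)]
      exact hbound _ _
  have hadm : IsAdmissible ν ρ := by
    refine isAdmissible_of_map ν (fun y => (e y, ξ y)) fun ε hε =>
      ⟨min ε 1, by positivity, fun x y hxy => ?_⟩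
    rw [Prod.dist_eq, max_lt_iff, lt_min_iff, lt_min_iff, Real.dist_eq] at hxy
    have hξxy : ξ x = ξ y := by
      by_contra hne
      exact absurd hxy.2.2 (not_lt.2 (Nat.pairwise_one_le_dist hne))
    simpa [ρ, hξxy] using hxy.1.1
  have hgen : IsGenerating ν W ρ := by
    refine ⟨Set.univ, by simp, fun x _ y _ hxy => ⟨0, ?_⟩⟩
    obtain ⟨g, hg⟩ := hW 0
    refine ⟨g, hg, add_pos_of_pos_of_nonneg (abs_pos.2 (sub_ne_zero.2 fun h => hxy ?_))
      (by split_ifs <;> simp)⟩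
    exact MulAction.injective g (hinj h)
  obtain ⟨ε₀, hε₀, hlim⟩ := h _ (epsEntropy_mem_scalingEntropy hsm hadm hgen)
  exact dynamicalPartitionEntropy_eq_zero hF hW hξ hH
    (tendsto_partitionEntropy_refine_div_card hW hξ hH hρ0 hρ1 hε₀ hlim)

end Semimetrics

/-! ### Covers of a topological system of zero entropy -/

section Topological

variable {G : Type*} [Group G] {X : Type*} [MetricSpace X] [MulAction G X]

/-- `X` is covered by `k` open sets of diameter at most `ε` for the average over `S` of the shifts
of the metric. -/
def HasOpenCover (X : Type*) [MetricSpace X] [MulAction G X] (S : Finset G) (ε : ℝ) (k : ℕ) :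
    Prop :=
  ∃ B : Fin k → Set X, (∀ i, IsOpen (B i)) ∧ (⋃ i, B i) = Set.univ ∧
    ∀ i, ∀ x ∈ B i, ∀ y ∈ B i, avgSemimetric S dist x y ≤ ε

/-- `N` is an `ε`-net for the semimetric `max_{g ∈ S} d (g x) (g y)`. -/
def IsDynamicalNet (S : Finset G) (ε : ℝ) (N : Finset X) : Prop :=
  ∀ x : X, ∃ y ∈ N, ∀ g ∈ S, dist (g • x) (g • y) < ε

variable [ContinuousConstSMul G X]

theorem isOpen_dynamicalBall (S : Finset G) (ε : ℝ) (y : X) :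
    IsOpen {x : X | ∀ g ∈ S, dist (g • x) (g • y) < ε} := by
  have : {x : X | ∀ g ∈ S, dist (g • x) (g • y) < ε} =
      ⋂ g ∈ S, {x : X | dist (g • x) (g • y) < ε} := by
    ext
    simp
  rw [this]
  exact isOpen_biInter_finset fun g _ =>
    isOpen_lt ((continuous_const_smul g).dist continuous_const) continuous_const

/-- Points are sorted by the net points that follow `c • x` for `c ∈ C`. Two points with a common
itinerary stay within `2 * ε` along every `t * c`, and the few elements of `V` cost at most `D`
each. -/
theorem hasOpenCover_of_translates {W T C V : Finset G} {N : Finset X} {ε δ D : ℝ}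
    (hN : IsDynamicalNet T ε N) (hε : 0 ≤ ε) (hD : ∀ x y : X, dist x y ≤ D) (hD0 : 0 ≤ D)
    (hW : W.Nonempty) (hV : (V.card : ℝ) ≤ δ * W.card)
    (hcov : ∀ w ∈ W, w ∈ V ∨ ∃ c ∈ C, ∃ t ∈ T, w = t * c) :
    HasOpenCover X W (2 * ε + δ * D) (N.card ^ C.card) := by
  classical
  have hcard : Fintype.card (C → N) = N.card ^ C.card := by simp
  let E := (Fintype.equivFinOfCardEq hcard).symm
  let B : (C → N) → Set X := fun s =>
    ⋂ c : C, (fun x => (c : G) • x) ⁻¹' {x | ∀ g ∈ T, dist (g • x) (g • (s c : X)) < ε}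
  refine ⟨fun i => B (E i), fun i => ?_, ?_, fun i x hx y hy => ?_⟩
  · exact isOpen_iInter_of_finite fun c =>
      (isOpen_dynamicalBall T ε _).preimage (continuous_const_smul (c : G))
  · refine Set.eq_univ_of_forall fun x => ?_
    choose s hs using fun c : C => hN ((c : G) • x)
    refine Set.mem_iUnion.2 ⟨E.symm fun c => ⟨s c, (hs c).1⟩, ?_⟩
    rw [Equiv.apply_symm_apply]
    exact Set.mem_iInter.2 fun c => (hs c).2
  · have hWpos : (0 : ℝ) < W.card := by exact_mod_cast hW.card_pos
    rw [avgSemimetric, div_le_iff₀ hWpos]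
    have hterm : ∀ w ∈ W, dist (w • x) (w • y) ≤ 2 * ε + if w ∈ V then D else 0 := by
      intro w hw
      rcases hcov w hw with h | ⟨c, hc, t, ht, rfl⟩
      · rw [if_pos h]
        linarith [hD (w • x) (w • y)]
      · have hx' := Set.mem_iInter.1 hx ⟨c, hc⟩ t ht
        have hy' := Set.mem_iInter.1 hy ⟨c, hc⟩ t ht
        have h1 := dist_triangle_right ((t * c) • x) ((t * c) • y) (t • (E i ⟨c, hc⟩ : X))
        simp only [smul_smul] at hx' hy'
        have h2 : 0 ≤ if t * c ∈ V then D else 0 := by split_ifs <;> simp [hD0]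
        linarith
    refine (Finset.sum_le_sum hterm).trans ?_
    rw [Finset.sum_add_distrib, Finset.sum_const, nsmul_eq_mul, Finset.sum_ite_mem,
      Finset.sum_const, nsmul_eq_mul]
    have h3 : ((W ∩ V).card : ℝ) ≤ V.card := by
      exact_mod_cast Finset.card_le_card Finset.inter_subset_right
    have h4 := mul_le_mul_of_nonneg_right (h3.trans hV) hD0
    linarith

variable [CompactSpace X]

theorem exists_isDynamicalNet (S : Finset G) {ε : ℝ} (hε : 0 < ε) :
    ∃ N : Finset X, IsDynamicalNet S ε N := by
  obtain ⟨N, -, hN⟩ := isCompact_univ.elim_nhds_subcover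
    (fun y : X => {x : X | ∀ g ∈ S, dist (g • x) (g • y) < ε})
    fun y _ => (isOpen_dynamicalBall S ε y).mem_nhds (by simpa using fun _ _ => hε)
  refine ⟨N, fun x => ?_⟩
  obtain ⟨y, hy, hxy⟩ := Set.mem_iUnion₂.1 (hN (Set.mem_univ x))
  exact ⟨y, hy, hxy⟩

theorem exists_isDynamicalNet_log_card_le {F : ℕ → Finset G} (hF : ∀ n, (F n).Nonempty)
    (h0 : topEntropy X F = 0) {ε η : ℝ} (hε : 0 < ε) (hη : 0 < η) :
    ∃ m, ∃ N : Finset X, IsDynamicalNet (F m) ε N ∧ Real.log N.card ≤ η * (F m).card := by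
  simp only [topEntropy, ENNReal.iSup_eq_zero] at h0
  have hlt := eventually_lt_of_limsup_lt ((h0 ε hε).trans_lt (ENNReal.ofReal_pos.2 hη))
    (by isBoundedDefault)
  obtain ⟨m, hm⟩ := hlt.exists
  have hcard : ((F m).card : ℝ≥0∞) ≠ 0 := by exact_mod_cast (hF m).card_pos.ne'
  rw [ENNReal.div_lt_iff (Or.inl hcard) (Or.inl (ENNReal.natCast_ne_top _)),
    ← ENNReal.ofReal_natCast, ← ENNReal.ofReal_mul hη.le] at hm
  -- Without this the infimum in `spn` could be the default value 0; compactness makes it attained.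
  have hne : {k : ℕ | ∃ N : Finset X, N.card = k ∧ IsDynamicalNet (F m) ε N}.Nonempty := by
    obtain ⟨N, hN⟩ := exists_isDynamicalNet (X := X) (F m) hε
    exact ⟨_, N, rfl, hN⟩
  obtain ⟨N, hNcard, hN⟩ := Nat.sInf_mem hne
  refine ⟨m, N, hN, ?_⟩
  rw [hNcard]
  exact (ENNReal.ofReal_le_ofReal_iff (by positivity)).1 hm.le

variable [Nonempty X]

theorem exists_hasOpenCover (S : Finset G) (hS : S.Nonempty) {ε : ℝ} (hε : 0 < ε) :
    ∃ k, 0 < k ∧ HasOpenCover X S ε k := by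
  obtain ⟨N, hN⟩ := exists_isDynamicalNet (X := X) S (half_pos hε)
  obtain ⟨y, hy, -⟩ := hN (Classical.arbitrary X)
  have := hasOpenCover_of_translates (W := S) (C := {1}) (V := ∅) (δ := 0)
    (D := Metric.diam (Set.univ : Set X)) hN (half_pos hε).le
    (fun x y => Metric.dist_le_diam_of_mem isCompact_univ.isBounded (Set.mem_univ x)
      (Set.mem_univ y)) Metric.diam_nonneg hS (by simp)
    fun w hw => Or.inr ⟨1, by simp, w, hw, by simp⟩
  rw [zero_mul, add_zero, mul_div_cancel₀ ε two_ne_zero] at this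
  exact ⟨_, pow_pos (Finset.card_pos.2 ⟨y, hy⟩) _, this⟩

theorem eventually_hasOpenCover_of_topEntropy_eq_zero {F W : ℕ → Finset G}
    (hF : ∀ n, (F n).Nonempty) (hW : IsLeftFolner W) (h0 : topEntropy X F = 0) {ε η : ℝ}
    (hε : 0 < ε) (hη : 0 < η) :
    ∀ᶠ n in atTop, ∃ k, 0 < k ∧ HasOpenCover X (W n) ε k ∧
      Real.logb 2 k ≤ η * (W n).card := by
  let D := Metric.diam (Set.univ : Set X) + 1
  have hDpos : 0 < D := add_pos_of_nonneg_of_pos Metric.diam_nonneg one_pos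
  have hD : ∀ x y : X, dist x y ≤ D := fun x y =>
    (Metric.dist_le_diam_of_mem isCompact_univ.isBounded (Set.mem_univ x)
      (Set.mem_univ y)).trans (le_add_of_nonneg_right zero_le_one)
  let δ := ε / 2 / D
  have hδ : 0 < δ := by positivity
  have hlog2 : 0 < Real.log 2 := Real.log_pos one_lt_two
  -- The diameters add up to `2 * (ε / 4) + δ * D = ε`; in the rate, `δ / 2` cancels the
  -- multiplicity `2 / δ` and `Real.log 2` changes the base.
  obtain ⟨m, N, hN, hNcard⟩ := exists_isDynamicalNet_log_card_le (X := X) hF h0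
    (ε := ε / 4) (η := η * Real.log 2 * δ / 2) (by positivity) (by positivity)
  obtain ⟨y, hy, -⟩ := hN (Classical.arbitrary X)
  filter_upwards [hW.exists_translate_cover hδ (hF m)] with n hn
  obtain ⟨C, V, hC, hV, hcov⟩ := hn
  refine ⟨N.card ^ C.card, pow_pos (Finset.card_pos.2 ⟨y, hy⟩) _, ?_, ?_⟩
  · convert hasOpenCover_of_translates hN (by positivity) hD hDpos.le (hW.nonempty n) hV hcov
      using 1
    simp only [δ]
    field_simp
    ring
  · rw [Real.logb, div_le_iff₀ hlog2, Nat.cast_pow, Real.log_pow]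
    calc (C.card : ℝ) * Real.log N.card
        ≤ C.card * (η * Real.log 2 * δ / 2 * (F m).card) := by gcongr
      _ = η * Real.log 2 * δ / 2 * ((F m).card * C.card) := by ring
      _ ≤ η * Real.log 2 * δ / 2 * (2 / δ * (W n).card) := by gcongr
      _ = η * (W n).card * Real.log 2 := by field_simp

/-- Along any Følner sequence, a system of zero topological entropy has covers by sets of small
average diameter whose cardinality grows subexponentially. -/
theorem exists_isLittleO_hasOpenCover {F W : ℕ → Finset G}
    (hF : ∀ n, (F n).Nonempty) (hW : IsLeftFolner W) (h0 : topEntropy X F = 0) {ε : ℝ}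
    (hε : 0 < ε) :
    ∃ a : ℕ → ℝ, (∀ n, 0 ≤ a n) ∧ a =o[atTop] (fun n => ((W n).card : ℝ)) ∧
      ∀ n, ∃ k, 0 < k ∧ HasOpenCover X (W n) ε k ∧ Real.logb 2 k ≤ a n := by
  let K : ℕ → ℕ := fun n => sInf {k | 0 < k ∧ HasOpenCover X (W n) ε k}
  have hK : ∀ n, 0 < K n ∧ HasOpenCover X (W n) ε (K n) := fun n =>
    Nat.sInf_mem (s := {k | 0 < k ∧ HasOpenCover X (W n) ε k})
      (exists_hasOpenCover (W n) (hW.nonempty n) hε)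
  have hnn : ∀ n, 0 ≤ Real.logb 2 (K n) := fun n =>
    Real.logb_nonneg one_lt_two (by exact_mod_cast (hK n).1)
  refine ⟨fun n => Real.logb 2 (K n), hnn, ?_, fun n => ⟨K n, (hK n).1, (hK n).2, le_rfl⟩⟩
  refine Asymptotics.isLittleO_iff.2 fun η hη => ?_
  filter_upwards [eventually_hasOpenCover_of_topEntropy_eq_zero hF hW h0 hε hη] with n hn
  obtain ⟨k, hk, hcov, hle⟩ := hn
  rw [Real.norm_of_nonneg (hnn n), Real.norm_of_nonneg (Nat.cast_nonneg _)]
  refine le_trans (Real.logb_le_logb_of_le one_lt_two ?_ ?_) hle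
  · exact_mod_cast (hK n).1
  · exact_mod_cast (Nat.sInf_le ⟨hk, hcov⟩ : K n ≤ k)

end Topological

/-- Countably many sequences negligible with respect to `w` are dominated, up to constants, by a
single one. -/
theorem exists_isLittleO_dominating {a : ℕ → ℕ → ℝ} {w : ℕ → ℝ} (ha : ∀ j n, 0 ≤ a j n)
    (hw : ∀ n, 0 < w n) (h : ∀ j, a j =o[atTop] w) :
    ∃ φ : ℕ → ℝ, (∀ n, 0 ≤ φ n) ∧ φ =o[atTop] w ∧
      ∀ j, ∃ C : ℝ, 0 < C ∧ ∀ n, a j n ≤ C * φ n := by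
  have hlim : ∀ j, Tendsto (fun n => a j n / w n) atTop (𝓝 0) := fun j =>
    (h j).tendsto_div_nhds_zero
  have hM : ∀ j, ∃ M : ℝ, 0 < M ∧ ∀ n, a j n / w n ≤ M := by
    intro j
    obtain ⟨M, hM⟩ := (hlim j).bddAbove_range
    exact ⟨max M 1, by positivity, fun n => (hM ⟨n, rfl⟩).trans (le_max_left _ _)⟩
  choose M hMpos hM using hM
  -- Normalizing by the suprema `M j` gives the summable majorant `2⁻ʲ`, so the limit passes through
  -- the sum over `j`.
  let b : ℕ → ℕ → ℝ := fun n j => (1 / 2) ^ j * (a j n / w n / M j)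
  have hb0 : ∀ n j, 0 ≤ b n j := fun n j => mul_nonneg (by positivity)
    (div_nonneg (div_nonneg (ha j n) (hw n).le) (hMpos j).le)
  have hb1 : ∀ n j, b n j ≤ (1 / 2) ^ j := fun n j =>
    mul_le_of_le_one_right (by positivity) ((div_le_one (hMpos j)).2 (hM j n))
  have hsum : ∀ n, Summable (b n) := fun n =>
    Summable.of_nonneg_of_le (hb0 n) (hb1 n) summable_geometric_two
  have htend : Tendsto (fun n => ∑' j, b n j) atTop (𝓝 0) := by
    have := tendsto_tsum_of_dominated_convergence (𝓕 := atTop) (f := b) (g := fun _ => 0)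
      summable_geometric_two
      (fun j => by
        have := ((hlim j).div_const (M j)).const_mul ((1 / 2 : ℝ) ^ j)
        rwa [zero_div, mul_zero] at this)
      (Eventually.of_forall fun n j => by rw [Real.norm_of_nonneg (hb0 n j)]; exact hb1 n j)
    simpa using this
  refine ⟨fun n => w n * ∑' j, b n j, fun n => mul_nonneg (hw n).le (tsum_nonneg (hb0 n)), ?_,
    fun j => ⟨2 ^ j * M j, mul_pos (by positivity) (hMpos j), fun n => ?_⟩⟩
  · rw [Asymptotics.isLittleO_iff_tendsto fun n hn => absurd hn (hw n).ne']
    simpa only [mul_div_cancel_left₀ _ (hw _).ne'] using htend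
  · have h1 : b n j ≤ ∑' j, b n j := (hsum n).le_tsum j fun i _ => hb0 n i
    have h2 : a j n = 2 ^ j * M j * (w n * b n j) := by
      have := (hw n).ne'
      have := (hMpos j).ne'
      simp only [b, one_div, inv_pow]
      field_simp
    rw [h2]
    exact mul_le_mul_of_nonneg_left (mul_le_mul_of_nonneg_left h1 (hw n).le)
      (mul_nonneg (by positivity) (hMpos j).le)

/-! ### Transport of the metric along an isomorphism -/

section Transport

variable {G : Type*} [Group G]

/-- Equivariance passes to the inverse: `p (g • y) = p (g • f (p y)) = p (f (g • p y)) = g • p y`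
almost everywhere, and countability of `G` gives one null set for all `g`. -/
theorem Isomorphic.exists_embedding [Countable G] {X Y : Type*} [MeasurableSpace X]
    [MeasurableSpace Y] [MulAction G X] [MulAction G Y] [MeasurableConstSMul G X]
    {μ : Measure X} {ν : Measure Y} [SMulInvariantMeasure G X μ]
    (h : Isomorphic G μ ν) :
    ∃ (f : X → Y) (p : Y → X), Measurable p ∧ (∀ᵐ y ∂ν, f (p y) = y) ∧
      ∀ᵐ y ∂ν, ∀ g : G, p (g • y) = g • p y := by
  obtain ⟨f, p, -, hp, hpf, hfp, hfg⟩ := h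
  refine ⟨f, p, hp.measurable, hfp, ae_all_iff.2 fun g => ?_⟩
  have h1 := hp.quasiMeasurePreserving.ae (hfg g)
  have h2 := hp.quasiMeasurePreserving.ae
    ((measurePreserving_smul g μ).quasiMeasurePreserving.ae hpf)
  filter_upwards [h1, h2, hfp] with y hy1 hy2 hy3
  rw [hy1, hy3] at hy2
  exact hy2

/-- The map `p` is injective where `f` inverts it, so a single shift by any `g ∈ W 0` already
separates points. -/
theorem isGenerating_dist_comp {X Y : Type*} [MetricSpace X] [MeasurableSpace Y]
    [MulAction G Y] {ν : Measure Y} [MeasurableConstSMul G Y] [SMulInvariantMeasure G Y ν]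
    {W : ℕ → Finset G} (hW : ∀ n, (W n).Nonempty) {p : Y → X} {f : X → Y}
    (hfp : ∀ᵐ y ∂ν, f (p y) = y) : IsGenerating ν W fun x y => dist (p x) (p y) := by
  obtain ⟨g, hg⟩ := hW 0
  have h := (measurePreserving_smul g ν).quasiMeasurePreserving.ae hfp
  refine ⟨{y | f (p (g • y)) = g • y}, ae_iff.1 h, fun x hx y hy hxy => ⟨0, g, hg, ?_⟩⟩
  refine dist_pos.2 fun heq => hxy (MulAction.injective g ?_)
  exact hx.symm.trans ((congrArg f heq).trans hy)

variable {X : Type*} [MetricSpace X] [MulAction G X]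
  {Y : Type*} [MeasurableSpace Y] [MulAction G Y] {ν : Measure Y}

/-- Off a null set, averaging commutes with pulling the metric back along `p`; that null set serves
as the exceptional piece. -/
theorem HasOpenCover.hasSmallCover [MeasurableSpace X] [OpensMeasurableSpace X] {p : Y → X}
    (hp : Measurable p) (hpg : ∀ᵐ y ∂ν, ∀ g : G, p (g • y) = g • p y) {S : Finset G} {ε ε' : ℝ}
    (hε : 0 < ε') (hεε' : ε < ε') {k : ℕ} (h : HasOpenCover X S ε k) :
    HasSmallCover ν (avgSemimetric S fun x y => dist (p x) (p y)) ε' k := by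
  obtain ⟨B, hBo, hBcov, hB⟩ := h
  obtain ⟨Z, hZsub, hZm, hZ0⟩ := exists_measurable_superset_of_null (ae_iff.1 hpg)
  have hZ : ∀ y ∉ Z, ∀ g : G, p (g • y) = g • p y := fun y hy => by
    by_contra hne
    exact hy (hZsub hne)
  refine ⟨Fin.cons Z fun i => p ⁻¹' B i ∩ Zᶜ, fun i => ?_, ?_, ?_, fun i hi => ?_⟩
  · refine Fin.cases hZm (fun i => ?_) i
    simpa using (hp (hBo i).measurableSet).inter hZm.compl
  · refine Set.eq_univ_of_forall fun y => ?_
    by_cases hy : y ∈ Z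
    · exact Set.mem_iUnion.2 ⟨0, by simpa using hy⟩
    · obtain ⟨i, hi⟩ := Set.mem_iUnion.1 (hBcov ▸ Set.mem_univ (p y))
      exact Set.mem_iUnion.2 ⟨i.succ, by simpa using ⟨hi, hy⟩⟩
  · simpa [hZ0] using hε
  · obtain ⟨i, rfl⟩ := Fin.exists_succ_eq.2 hi
    refine lt_of_le_of_lt ?_ ((ENNReal.ofReal_lt_ofReal_iff hε).2 hεε')
    rw [Fin.cons_succ]
    refine iSup₂_le fun x hx => iSup₂_le fun y hy => ENNReal.ofReal_le_ofReal ?_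
    simpa only [avgSemimetric, hZ x hx.2, hZ y hy.2] using hB i _ hx.1 _ hy.1

theorem isSummableSemimetric_dist_comp [CompactSpace X] [MeasurableSpace X] [BorelSpace X]
    [IsFiniteMeasure ν] {p : Y → X} (hp : Measurable p) :
    IsSummableSemimetric ν fun x y => dist (p x) (p y) := by
  refine ⟨fun x => dist_self _, fun _ _ => dist_nonneg, fun _ _ => dist_comm _ _,
    fun _ _ _ => dist_triangle _ _ _, ?_⟩
  refine Integrable.of_bound (C := Metric.diam (Set.univ : Set X))
    ((hp.comp measurable_fst).dist (hp.comp measurable_snd)).aestronglyMeasurable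
    (ae_of_all _ fun q => ?_)
  rw [Real.norm_of_nonneg dist_nonneg]
  exact Metric.dist_le_diam_of_mem isCompact_univ.isBounded (Set.mem_univ _) (Set.mem_univ _)

end Transport

end ScalingEntropy

end

theorem mainTheorem4 {G : Type*} [Group G] [Countable G]
    {X : Type*} [MetricSpace X] [CompactSpace X] [MeasurableSpace X] [BorelSpace X]
    [MulAction G X] [ContinuousConstSMul G X]
    (F W : ℕ → Finset G)
    (hF : ScalingEntropy.IsLeftFolner F) (hW : ScalingEntropy.IsLeftFolner W)
    (hgrowth : ScalingEntropy.AdmitsAlmostCompleteGrowth W)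
    (huniv : ∀ S : ScalingEntropy.MPSystem G, ScalingEntropy.measureEntropy S.measure F = 0 →
      ∃ μ : MeasureTheory.Measure X, MeasureTheory.IsProbabilityMeasure μ ∧
        MeasureTheory.SMulInvariantMeasure G X μ ∧
        ScalingEntropy.Isomorphic G μ S.measure) :
    0 < ScalingEntropy.topEntropy X F := by
  open ScalingEntropy in
  by_contra hpos
  have h0 : topEntropy X F = 0 := by simpa using hpos
  have hmodel : ∀ φ : ℕ → ℝ, (∀ n, 0 ≤ φ n) → φ =o[atTop] (fun n => ((W n).card : ℝ)) →
      ∃ S : MPSystem G, (∀ Φ ∈ scalingEntropy S.measure W, ∃ ε₀ : ℝ, 0 < ε₀ ∧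
        ∀ ε : ℝ, 0 < ε → ε < ε₀ → ¬ Dominated (fun n => Φ n ε) fun n => ENNReal.ofReal (φ n)) ∧
        ∃ μ : Measure X, IsProbabilityMeasure μ ∧ SMulInvariantMeasure G X μ ∧
          Isomorphic G μ S.measure := by
    intro φ hφ0 hφ
    obtain ⟨S, hS⟩ := hgrowth φ hφ0 hφ
    refine ⟨S, fun Φ hΦ => ?_, huniv S ?_⟩
    · obtain ⟨ε₀, hε₀, h⟩ := hS Φ hΦ
      exact ⟨ε₀, hε₀, fun ε h1 h2 => (h ε h1 h2).1⟩
    · refine measureEntropy_eq_zero_of_scalingEntropy hF hW.nonempty fun Φ hΦ => ?_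
      obtain ⟨ε₀, hε₀, h⟩ := hS Φ hΦ
      exact ⟨ε₀, hε₀, fun ε h1 h2 => (h ε h1 h2).2⟩
  -- Even `φ = 0` yields a system realized on `X`, and a probability measure needs a point.
  have hX : Nonempty X := by
    obtain ⟨S, -, μ, hμ, -⟩ := hmodel (fun _ => 0) (fun _ => le_rfl)
      (Asymptotics.isLittleO_zero _ _)
    exact nonempty_of_isProbabilityMeasure μ
  choose a ha0 ha hacov using fun j : ℕ => exists_isLittleO_hasOpenCover (X := X) hF.nonempty hW h0
    (ε := 1 / ((j : ℝ) + 1)) (by positivity)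
  obtain ⟨φ, hφ0, hφ, hφa⟩ := exists_isLittleO_dominating ha0
    (fun n => by exact_mod_cast (hW.nonempty n).card_pos) ha
  -- The threshold `ε₀` is known only after `S`, and `S` depends on `φ`; hence `φ` had to handle all
  -- scales `1 / (j + 1)` beforehand.
  obtain ⟨S, hS, μ, hμ, hinv, hiso⟩ := hmodel φ hφ0 hφ
  obtain ⟨f, p, hp, hfp, hpg⟩ := hiso.exists_embedding
  obtain ⟨ε₀, hε₀, hdom⟩ := hS _ (epsEntropy_mem_scalingEntropy
    (isSummableSemimetric_dist_comp (ν := S.measure) hp)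
    (isAdmissible_of_map _ p fun ε hε => ⟨ε, hε, fun _ _ h => h⟩)
    (isGenerating_dist_comp hW.nonempty hfp))
  obtain ⟨j, hj⟩ := exists_nat_one_div_lt (half_pos hε₀)
  obtain ⟨C, hC, hCa⟩ := hφa j
  refine hdom (ε₀ / 2) (half_pos hε₀) (half_lt_self hε₀)
    ⟨⟨C, hC.le⟩, hC, fun n => ?_⟩
  obtain ⟨k, hk, hcov, hle⟩ := hacov j n
  calc epsEntropy S.measure (avgSemimetric (W n) fun x y => dist (p x) (p y)) (ε₀ / 2)
      ≤ ENNReal.ofReal (Real.logb 2 k) :=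
        iInf₂_le k ⟨hk, hcov.hasSmallCover hp hpg (half_pos hε₀) hj⟩
    _ ≤ ENNReal.ofReal (C * φ n) := ENNReal.ofReal_le_ofReal (hle.trans (hCa n))
    _ = _ := by
        rw [ENNReal.ofReal_mul hC.le, ENNReal.ofReal_eq_coe_nnreal hC.le]
        rfl
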